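/- **Setting.** Let $0<R_f'<R_f''$. Let $v_f\in C^2([0,R_f''];[0,\infty))$ with $v_f(R_f'')>0$ and, on $[0,R_f'']$, $v_f'\le 0$, $v_f+\rho v_f'>0$, $2v_f'+\rho v_f''\le 0$. Let $p\in C^2([R_f',\infty))$ with $p'>0$ and $2p'+\rho p''>0$; assume that $v_f+p$ is increasing on $[R_f',R_f'']$ and $v_f(\rho)<\rho p'(\rho)$ there. Put $V_{\max}=v_f(0)$, $V_f=v_f(R_f'')$, $W_{\max}=p(R_f'')+V_f$, $W_c=p(R_f')+v_f(R_f')$, $W_{\min}=W_c+v_f(R_f')-V_{\max}$, assume that $R_{\max}=p^{-1}(W_{\max})$ exists, and fix $V_c\in(0,V_f)$. States are $u=(\rho,v)$. Let $$\Omega_f=\{\rho\in[0,R_f''],\ v=v_f(\rho)\},\qquad \Omega_c=\{\rho\in[R_f',R_{\max}],\ v\in[0,V_c],\ W_c\le v+p(\rho)\le W_{\max}\},$$ $\Omega=\Omega_f\cup\Omega_c$, $\Omega_f'=\Omega_f\cap\{\rho<R_f'\}$, $\Omega_f''=\Omega_f\cap\{\rho\ge R_f'\}$. Let $w_1(u)=V_f$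 on $\Omega_f$ and $w_1(u)=v$ on $\Omega_c$; let $w_2(u)=W_c+v_f(R_f')-v_f(\rho)$ on $\Omega_f'$ and $w_2(u)=v+p(\rho)$ on $\Omega_c\cup\Omega_f''$. For $w\in[W_c,W_{\max}]$ let $\rho_f(w)\in[R_f',R_f'']$ be the solution of $v_f(\rho)+p(\rho)=w$. Let $\sigma(u_-,u_+)=(\rho_+v_+-\rho_-v_-)/(\rho_+-\rho_-)$ and $\mathcal G_e=\mathcal G_1\cup\mathcal G_2\cup\mathcal G_3$, where $$\mathcal G_1=\{(u_-,u_+)\in\Omega_f'\times\Omega_c:[w_2(u_+)-W_c]\rho_-=0\},\quad \mathcal G_2=\{(u_-,u_+)\in\Omega_f''\times\Omega_c: w_2(u_-)=w_2(u_+)\},$$ $$\mathcal G_3=\{(u_-,u_+)\in\Omega_c\times\Omega_f'': w_2(u_-)=w_2(u_+),\ v_-=V_c\}.$$ **Grid and approximate Riemann solver.** For $n\in\mathbb N$ let $\varepsilon_v=2^{-n}V_c$, $\varepsilon_w=2^{-n}(W_c-W_{\min})$, and let $\Omega^n$ be the set of $u\in\Omega$ with $w_2(u)\in\{W_{\min}+i\varepsilon_w: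 i\in\mathbb N\}\cap(-\infty,W_{\max}]$ and $w_1(u)\in\{i\varepsilon_v:0\le i\le 2^n\}\cup\{V_f\}$. The approximate Riemann solver $\mathcal R^n[u_\ell,u_r]$, $u_\ell,u_r\in\Omega^n$, is the self-similar piecewise constant function whose successive states, separated by fronts of speed $\sigma$, are obtained as follows (null waves are dropped). * $u_\ell,u_r\in\Omega_f$: one shock if $\rho_\ell<\rho_r$; if $\rho_\ell>\rho_r$, the rarefaction discretized by the free states with $w_2=w_2(u_\ell)-i\varepsilon_w$ (a single jump if $w_2(u_\ell)=w_2(u_r)$). * $u_\ell,u_r\in\Omega_c$: with $u_m\in\Omega_c$ given by $v_m=v_r$, $w_2(u_m)=w_2(u_\ell)$, a shock from $u_\ell$ to $u_m$ if $v_r<v_\ell$, or, if $v_r>v_\ell$, the rarefaction discretized by the states of $\Omega_c$ with $w_1=v_\ell+i\varepsilon_v$, $w_2=w_2(u_\ell)$; then a contact discontinuity from $u_m$ to $u_r$. * $u_\ell\in\Omega_f$, $u_r\in\Omega_c$: a jump from $u_\ell$ to $u_m\in\Omega_c$ given by $v_m=v_r$, $w_2(u_m)=\max\{W_c,w_2(u_\ell)\}$,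 then a contact discontinuity from $u_m$ to $u_r$ (if $\rho_\ell=0$ both have the same speed and form a single front). * $u_\ell\in\Omega_c$, $u_r\in\Omega_f$: the (discretized) rarefaction from $u_\ell$ to $u_m'\in\Omega_c$ given by $v_m'=V_c$, $w_2(u_m')=w_2(u_\ell)$; a jump from $u_m'$ to $u_m''=(\rho_m'',v_f(\rho_m''))$ with $\rho_m''=\rho_f(w_2(u_\ell))$; the (discretized) free wave from $u_m''$ to $u_r$. **Approximate solution.** Let $\bar u^n:\mathbb R\to\Omega^n$ be right continuous and piecewise constant with finitely many jumps. The wave-front tracking approximate solution $u^n$ is obtained by applying $\mathcal R^n$ at every jump of $\bar u^n$ at $t=0$, letting the fronts move with their speeds $\sigma$ until the first time two of them meet, applying $\mathcal R^n$ again at the jumps of the function so reached, and so on; at interaction times it is taken left continuous in time (so at an interaction point the interacting fronts form a single jump). It is considered at all times $t\ge 0$ that this construction reaches after finitely many interaction times. A *phase transition* of a function at $x$ is a jump at $x$ with one trace in $\Omega_f$ and the other one in $\Omega_c$; two discontinuities (or two phase transitions) *interact* at $(\tau,x)$, $\tau>0$, if two distinct curves of discontinuities (phase transitions) of $u^n$,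 defined for times in a left neighbourhood of $\tau$, both tend to $x$ as $t\uparrow\tau$. Let $N(t)$ be the number of phase transitions of $x\mapsto u^n(t,x)$. **Lemma.** For every $n$ and every such $\bar u^n$: 1. (Condition (E.3).) If $t>0$ and $u^n(t,\cdot)$ performs at $x$ a phase transition from $u_-$ to $u_+$, and $(t,x)$ is not a point where discontinuities interact, then $(u_-,u_+)\in\mathcal G_e$. 2. $N(t)<\infty$ for all $t\ge 0$, and $N(t)\le N(s)$ whenever $0\le s\le t$. 3. For $0\le s\le t$, $N(t)<N(s)$ if and only if two phase transitions interact at some $(\tau,x)$ with $s<\tau\le t$. 4. For $0\le s\le t$, $N(s)-N(t)$ is even. -/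

import Mathlib

open Set Filter Topology

namespace TwoPhase

/-- A traffic state `u = (ρ, v)`: density and velocity. -/
abbrev State := ℝ × ℝ

/-- The data of the two phase model and its standing assumptions. `Rf₁` and `Rf₂` are the
densities `R_f'` and `R_f''`; `Rmax = p⁻¹(W_max)` with `W_max = p(R_f'') + v_f(R_f'')`.
`vf` is only relevant on `[0, R_f'']` and `p` only on `[R_f', ∞)`. -/
structure Model where
  vf : ℝ → ℝ
  p : ℝ → ℝ
  Rf₁ : ℝ
  Rf₂ : ℝ
  Rmax : ℝ
  Vc : ℝ
  Rf₁_pos : 0 < Rf₁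
  Rf₁_lt : Rf₁ < Rf₂
  -- (H1)
  vf_contDiff : ContDiffOn ℝ 2 vf (Icc 0 Rf₂)
  vf_nonneg : ∀ ρ ∈ Icc 0 Rf₂, 0 ≤ vf ρ
  vf_pos : 0 < vf Rf₂
  vf_deriv : ∀ ρ ∈ Icc 0 Rf₂, derivWithin vf (Icc 0 Rf₂) ρ ≤ 0
  vf_flux : ∀ ρ ∈ Icc 0 Rf₂, 0 < vf ρ + ρ * derivWithin vf (Icc 0 Rf₂) ρ
  vf_concave : ∀ ρ ∈ Icc 0 Rf₂,
    2 * derivWithin vf (Icc 0 Rf₂) ρ + ρ * iteratedDerivWithin 2 vf (Icc 0 Rf₂) ρ ≤ 0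
  -- (H2)
  p_contDiff : ContDiffOn ℝ 2 p (Ici Rf₁)
  p_deriv : ∀ ρ ∈ Ici Rf₁, 0 < derivWithin p (Ici Rf₁) ρ
  p_convex : ∀ ρ ∈ Ici Rf₁,
    0 < 2 * derivWithin p (Ici Rf₁) ρ + ρ * iteratedDerivWithin 2 p (Ici Rf₁) ρ
  -- (H3)
  vf_add_p : StrictMonoOn (fun ρ => vf ρ + p ρ) (Icc Rf₁ Rf₂)
  capacity_drop : ∀ ρ ∈ Icc Rf₁ Rf₂, vf ρ < ρ * derivWithin p (Ici Rf₁) ρ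
  -- the maximal density and the maximal congested velocity
  Rmax_ge : Rf₁ ≤ Rmax
  p_Rmax : p Rmax = p Rf₂ + vf Rf₂
  Vc_pos : 0 < Vc
  Vc_lt : Vc < vf Rf₂

/-- Speed of propagation of a discontinuity from `a` to `b`. -/
noncomputable def sigma (a b : State) : ℝ := (b.1 * b.2 - a.1 * a.2) / (b.1 - a.1)

/-- The piecewise constant, right continuous function with leftmost state `ul` that takes the value
`u` to the right of `y` for each entry `(y, u)` of the list (ordered from left to right). If several
consecutive entries sit at the same point, the last one counts. -/
noncomputable def profile : State → List (ℝ × State) → ℝ → State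
  | ul, [], _ => ul
  | ul, (y, u) :: L, x => if x < y then ul else profile u L x

/-- Positions of the wave-fronts after time `s`, each one moving with its speed `sigma`. -/
noncomputable def evolve : State → List (ℝ × State) → ℝ → List (ℝ × State)
  | _, [], _ => []
  | ul, (y, u) :: L, s => (y + sigma ul u * s, u) :: evolve u L s

/-- The times at which two consecutive approaching wave-fronts meet. -/
noncomputable def meetTimes : State → List (ℝ × State) → List ℝ
  | ul, (y, u) :: (y', u') :: L =>
      if sigma u u' < sigma ul u then
        (y' - y) / (sigma ul u - sigma u u') :: meetTimes u ((y', u') :: L)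
      else meetTimes u ((y', u') :: L)
  | _, _ => []

/-- Replaces consecutive fronts at the same position by a single jump. -/
noncomputable def collapse : List (ℝ × State) → List (ℝ × State)
  | a :: b :: L => if a.1 = b.1 then collapse (b :: L) else a :: collapse (b :: L)
  | L => L

/-- Two distinct continuous curves of points satisfying `P`, defined on a left neighbourhood of
`t`, meet at `(t, x)`. -/
def MeetAt (P : ℝ → ℝ → Prop) (t x : ℝ) : Prop :=
  ∃ δ > 0, ∃ ξ₁ ξ₂ : ℝ → ℝ,
    ContinuousOn ξ₁ (Ioo (t - δ) t) ∧ ContinuousOn ξ₂ (Ioo (t - δ) t) ∧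
    Tendsto ξ₁ (𝓝[<] t) (𝓝 x) ∧ Tendsto ξ₂ (𝓝[<] t) (𝓝 x) ∧
    ∀ s ∈ Ioo (t - δ) t, ξ₁ s < ξ₂ s ∧ P s (ξ₁ s) ∧ P s (ξ₂ s)

/-- Two discontinuities of `u` interact at `(t, x)`. -/
def FrontsInteract (u : ℝ → ℝ → State) (t x : ℝ) : Prop :=
  MeetAt (fun s y => ¬ ContinuousAt (u s) y) t x

namespace Model

variable (M : Model)

def Vmax : ℝ := M.vf 0
def Vf : ℝ := M.vf M.Rf₂
def Wmax : ℝ := M.p M.Rf₂ + M.Vf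
def Wc : ℝ := M.p M.Rf₁ + M.vf M.Rf₁
def Wmin : ℝ := M.Wc + M.vf M.Rf₁ - M.Vmax

/-- Free phases. -/
def Omegaf : Set State := {u | u.1 ∈ Icc 0 M.Rf₂ ∧ u.2 ∈ Icc M.Vf M.Vmax ∧ u.2 = M.vf u.1}

/-- Congested phases (`p` is defined only for `ρ ≥ R_f'`). -/
def Omegac : Set State :=
  {u | u.1 ∈ Icc M.Rf₁ M.Rmax ∧ u.2 ∈ Icc 0 M.Vc ∧ u.2 + M.p u.1 ∈ Icc M.Wc M.Wmax}

def Omegaf₁ : Set State := {u | u ∈ M.Omegaf ∧ u.1 < M.Rf₁}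
def Omegaf₂ : Set State := {u | u ∈ M.Omegaf ∧ M.Rf₁ ≤ u.1}
def Omega : Set State := M.Omegaf ∪ M.Omegac

open Classical in
/-- First extended Riemann invariant. -/
noncomputable def w1 (u : State) : ℝ := if u ∈ M.Omegaf then M.Vf else u.2

open Classical in
/-- Second extended Riemann invariant. -/
noncomputable def w2 (u : State) : ℝ :=
  if u ∈ M.Omegaf₁ then M.Wc + M.vf M.Rf₁ - M.vf u.1 else u.2 + M.p u.1

/-- The inverse of the increasing function `p` on `[R_f', R_max]`. -/
noncomputable def pinv (w : ℝ) : ℝ := Function.invFunOn M.p (Icc M.Rf₁ M.Rmax) w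

/-- The density `ρ_f(w) ∈ [R_f', R_f'']` with `v_f(ρ) + p(ρ) = w`, for `w ∈ [W_c, W_max]`. -/
noncomputable def rhof (w : ℝ) : ℝ :=
  Function.invFunOn (fun ρ => M.vf ρ + M.p ρ) (Icc M.Rf₁ M.Rf₂) w

/-- The congested state with Riemann invariants `(v, w)`. -/
noncomputable def congState (v w : ℝ) : State := (M.pinv (w - v), v)

/-- The free state with second Riemann invariant `w`. -/
noncomputable def freeState (w : ℝ) : State := Function.invFunOn M.w2 M.Omegaf w

/-! ### Admissible phase transitions -/

def G1 : Set (State × State) :=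
  {q | q.1 ∈ M.Omegaf₁ ∧ q.2 ∈ M.Omegac ∧ (M.w2 q.2 - M.Wc) * q.1.1 = 0}
def G2 : Set (State × State) :=
  {q | q.1 ∈ M.Omegaf₂ ∧ q.2 ∈ M.Omegac ∧ M.w2 q.1 = M.w2 q.2}
def G3 : Set (State × State) :=
  {q | q.1 ∈ M.Omegac ∧ q.2 ∈ M.Omegaf₂ ∧ M.w2 q.1 = M.w2 q.2 ∧ q.1.2 = M.Vc}
def Ge : Set (State × State) := M.G1 ∪ M.G2 ∪ M.G3

/-! ### The grid and the approximate Riemann solver -/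

noncomputable def epsv (n : ℕ) : ℝ := M.Vc / 2 ^ n
noncomputable def epsw (n : ℕ) : ℝ := (M.Wc - M.Wmin) / 2 ^ n

def gridW (n : ℕ) : Set ℝ := {w | (∃ i : ℕ, w = M.Wmin + i * M.epsw n) ∧ w ≤ M.Wmax}
def gridV (n : ℕ) : Set ℝ := {v | ∃ i : ℕ, i ≤ 2 ^ n ∧ v = i * M.epsv n} ∪ {M.Vf}
def grid (n : ℕ) : Set State := {u | u ∈ M.Omega ∧ M.w1 u ∈ M.gridV n ∧ M.w2 u ∈ M.gridW n}

open Classical in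
/-- The wave from `ul` to `ur` in the free phase, as the list of the states following `ul`: nothing
if the states agree, a discretized rarefaction if the density decreases, a shock if it increases. -/
noncomputable def freeWave (n : ℕ) (ul ur : State) : List State :=
  if ul = ur then []
  else if ur.1 < ul.1 then
    (List.range (⌊(M.w2 ul - M.w2 ur) / M.epsw n⌋₊ - 1)).map
      (fun i => M.freeState (M.w2 ul - (i + 1 : ℕ) * M.epsw n)) ++ [ur]
  else [ur]

open Classical in
/-- The wave of the first family from the congested state `ul` to the state with velocity `v` and
the same second Riemann invariant, as the list of the states following `ul`: nothing if the velocity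
agrees, a discretized rarefaction if it increases, a shock if it decreases. -/
noncomputable def firstWave (n : ℕ) (ul : State) (v : ℝ) : List State :=
  if ul.2 = v then []
  else if ul.2 < v then
    (List.range (⌊(v - ul.2) / M.epsv n⌋₊ - 1)).map
      (fun i => M.congState (ul.2 + (i + 1 : ℕ) * M.epsv n) (M.w2 ul)) ++ [M.congState v (M.w2 ul)]
  else [M.congState v (M.w2 ul)]

open Classical in
/-- A possibly null contact discontinuity. -/
noncomputable def contact (um ur : State) : List State := if um = ur then [] else [ur]

open Classical in
/-- The approximate Riemann solver `ℛⁿ[ul, ur]`: the list of the states following `ul`, from left to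
right, the last one being `ur`; consecutive states are separated by a front of speed `sigma`. -/
noncomputable def riemann (n : ℕ) (ul ur : State) : List State :=
  if ul ∈ M.Omegaf then
    if ur ∈ M.Omegaf then M.freeWave n ul ur
    else
      let um := M.congState ur.2 (max M.Wc (M.w2 ul))
      um :: contact um ur
  else
    if ur ∈ M.Omegaf then
      let um : State := (M.rhof (M.w2 ul), M.vf (M.rhof (M.w2 ul)))
      M.firstWave n ul M.Vc ++ um :: M.freeWave n um ur
    else M.firstWave n ul ur.2 ++ contact (M.congState ur.2 (M.w2 ul)) ur

/-! ### The wave-front tracking approximate solution -/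

/-- Applies the approximate Riemann solver at each jump of a piecewise constant function. -/
noncomputable def resolve (n : ℕ) : State → List (ℝ × State) → List (ℝ × State)
  | _, [] => []
  | ul, (y, u) :: L => (M.riemann n ul u).map (fun a => (y, a)) ++ resolve n u L

/-- The wave-front tracking algorithm, started from the piecewise constant function with leftmost
state `ul` and jumps `J`. The `k`-th entry is the `k`-th interaction time (`0` for `k = 0`, and `⊤`
if there are less than `k` interaction times), with the fronts that issue from it. -/
noncomputable def tracking (n : ℕ) (ul : State) (J : List (ℝ × State)) :
    ℕ → WithTop ℝ × List (ℝ × State)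
  | 0 => (0, M.resolve n ul J)
  | k + 1 =>
      let T := (tracking n ul J k).1
      let L := (tracking n ul J k).2
      let τ := (meetTimes ul L).minimum
      (T + τ, M.resolve n ul (collapse (evolve ul L (τ.untopD 0))))

/-- The `k`-th interaction time. -/
noncomputable def time (n : ℕ) (ul : State) (J : List (ℝ × State)) (k : ℕ) : WithTop ℝ :=
  (M.tracking n ul J k).1

/-- The time `t` is reached by the algorithm after finitely many interactions. -/
def Reached (n : ℕ) (ul : State) (J : List (ℝ × State)) (t : ℝ) : Prop :=
  ∃ k, (t : WithTop ℝ) ≤ M.time n ul J k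

open Classical in
/-- The approximate solution `uⁿ(t, x)`, left continuous in time. It is meaningful for the times
`t ≥ 0` that are reached. -/
noncomputable def approx (n : ℕ) (ul : State) (J : List (ℝ × State)) (t x : ℝ) : State :=
  if h : ∃ k, M.time n ul J k < t ∧ (t : WithTop ℝ) ≤ M.time n ul J (k + 1) then
    profile ul (evolve ul (M.tracking n ul J h.choose).2
      (t - (M.time n ul J h.choose).untopD 0)) x
  else profile ul J x

/-! ### Phase transitions -/

/-- The function `g` performs a phase transition at `x`, with traces `um` and `up`. -/
def IsPhaseTransition (g : ℝ → State) (x : ℝ) (um up : State) : Prop :=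
  Tendsto g (𝓝[<] x) (𝓝 um) ∧ Tendsto g (𝓝[>] x) (𝓝 up) ∧
    ((um ∈ M.Omegaf ∧ up ∈ M.Omegac) ∨ (um ∈ M.Omegac ∧ up ∈ M.Omegaf))

/-- The points at which `g` performs a phase transition. -/
def phaseTransitions (g : ℝ → State) : Set ℝ := {x | ∃ um up, M.IsPhaseTransition g x um up}

/-- The number of phase transitions performed by `g`. -/
noncomputable def numPT (g : ℝ → State) : ℕ := (M.phaseTransitions g).ncard

/-- Two phase transitions of `u` interact at `(t, x)`. -/
def PhaseTransitionsInteract (u : ℝ → ℝ → State) (t x : ℝ) : Prop :=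
  MeetAt (fun s y => y ∈ M.phaseTransitions (u s)) t x

end Model

end TwoPhase

/-! The solution of one Riemann problem is a fan with nondecreasing speeds that changes phase at
most once, and this change is an admissible phase transition. Since each change of phase toggles
membership in `Omegaf`, the outer states decide whether there is one: it occurs exactly when they
lie in different phases. So if `c` phase transitions arrive at a point, the new fan contains one
phase transition when `c` is odd and none when `c` is even. The number lost is `2 * (c / 2)`: always
even, and nonzero exactly when `c ≥ 2`, that is, when two phase transitions meet there. Summing over
points and over interaction times gives monotonicity, the criterion for strict decrease and the
parity.

The fans are controlled by comparing speeds (`riemann_isFan`). On a curve `v + p ρ = w` the flux is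
strictly concave, so the fronts of a first family wave are strictly ordered, and they are slower
than the following contact. The capacity drop makes the jump from the congested to the free phase
move backwards, while free fronts move forwards.

Equal speeds inside a fan do occur: the jump from the vacuum travels with the contact that follows
it, and the free flux is only weakly concave. Fronts with the same origin and the same speed stay
together for ever and form one discontinuity. Fronts are therefore keyed by (origin, speed) in
lexicographic order, and admissibility is required of the two traces at a key, not of consecutive
states.

Until the next meeting time the order of the keys is the order of the positions, strictly so in the
interior (`position_strictMono`). Hence the phase transitions move along fixed lines
(`mem_phaseTransitions_evolve`). At the meeting time some of these lines merge, and a point carries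
a phase transition exactly when an odd number of crossings arrive there (`odd_count_crossings`).
`resolve_isResolved` restarts the process with the same number of phase transitions, and
`phaseChanges_add` and `numPT_evolution` collect the steps. Condition (E.3) follows because away
from interaction points all fronts at a point share one key (`mem_Ge_or_exists_lt`). -/

namespace TwoPhase

/-! ### Step functions with keys in a linear order -/

section Steps

variable {K K' : Type*}

/-- The rightmost state. -/
def lastState : State → List (K × State) → State
  | ul, [] => ul
  | _, (_, u) :: L => lastState u L

open Classical in
/-- The keys of the jumps that enter or leave the set `F`. -/
noncomputable def crossings (F : Set State) : State → List (K × State) → List K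
  | _, [] => []
  | ul, (y, u) :: L => if (ul ∈ F ↔ u ∈ F) then crossings F u L else y :: crossings F u L

theorem lastState_append (ul : State) (A B : List (K × State)) :
    lastState ul (A ++ B) = lastState (lastState ul A) B := by
  induction A generalizing ul with
  | nil => rfl
  | cons a A ih => exact ih _

theorem lastState_map (ul : State) (L : List (K × State)) (f : K → K') :
    lastState ul (L.map (Prod.map f id)) = lastState ul L := by
  induction L generalizing ul with
  | nil => rfl
  | cons a A ih => exact ih _

theorem crossings_append (F : Set State) (ul : State) (A B : List (K × State)) :
    crossings F ul (A ++ B) = crossings F ul A ++ crossings F (lastState ul A) B := by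
  induction A generalizing ul with
  | nil => rfl
  | cons a A ih =>
    obtain ⟨y, u⟩ := a
    simp only [List.cons_append, crossings, lastState]
    split_ifs <;> simp [ih]

theorem crossings_map (F : Set State) (ul : State) (L : List (K × State)) (f : K → K') :
    crossings F ul (L.map (Prod.map f id)) = (crossings F ul L).map f := by
  induction L generalizing ul with
  | nil => rfl
  | cons a A ih =>
    obtain ⟨y, u⟩ := a
    simp only [List.map_cons, crossings, Prod.map_apply, id]
    split_ifs <;> simp [ih]

theorem crossings_sublist (F : Set State) (ul : State) (L : List (K × State)) :
    (crossings F ul L).Sublist (L.map Prod.fst) := by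
  induction L generalizing ul with
  | nil => simp [crossings]
  | cons a A ih =>
    obtain ⟨y, u⟩ := a
    simp only [List.map_cons, crossings]
    split_ifs
    · exact (ih u).cons _
    · exact (ih u).cons_cons _

theorem exists_mem_of_mem_crossings {F : Set State} {ul : State} {L : List (K × State)} {k : K}
    (h : k ∈ crossings F ul L) : ∃ a ∈ L, a.1 = k := by
  simpa using (crossings_sublist F ul L).subset h

variable [LinearOrder K] [LinearOrder K']

/-- The value, to the left of `x`, of the step function with leftmost state `ul` and jumps `L`. -/
def leftTrace : State → List (K × State) → K → State
  | ul, [], _ => ul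
  | ul, (y, u) :: L, x => if y < x then leftTrace u L x else ul

/-- The value, to the right of `x`, of the step function with leftmost state `ul` and jumps `L`. -/
def rightTrace : State → List (K × State) → K → State
  | ul, [], _ => ul
  | ul, (y, u) :: L, x => if x < y then ul else rightTrace u L x

/-- At each jump the two traces are related by `Q`. -/
def JumpsSatisfy (Q : State → State → Prop) (ul : State) (L : List (K × State)) : Prop :=
  ∀ a ∈ L, Q (leftTrace ul L a.1) (rightTrace ul L a.1)

theorem leftTrace_mem (ul : State) (L : List (K × State)) (x : K) :
    leftTrace ul L x ∈ ul :: L.map Prod.snd := by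
  induction L generalizing ul with
  | nil => simp [leftTrace]
  | cons a L ih =>
    obtain ⟨y, u⟩ := a
    simp only [leftTrace]
    split_ifs
    · exact List.mem_cons_of_mem _ (ih u)
    · simp

theorem rightTrace_mem (ul : State) (L : List (K × State)) (x : K) :
    rightTrace ul L x ∈ ul :: L.map Prod.snd := by
  induction L generalizing ul with
  | nil => simp [rightTrace]
  | cons a L ih =>
    obtain ⟨y, u⟩ := a
    simp only [rightTrace]
    split_ifs
    · simp
    · exact List.mem_cons_of_mem _ (ih u)

theorem leftTrace_eq_of_forall_le {ul : State} {L : List (K × State)} {x : K}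
    (h : ∀ a ∈ L, x ≤ a.1) : leftTrace ul L x = ul := by
  cases L with
  | nil => rfl
  | cons a L => simp [leftTrace, not_lt.2 (h a (by simp))]

theorem rightTrace_eq_of_forall_lt {ul : State} {L : List (K × State)} {x : K}
    (h : ∀ a ∈ L, x < a.1) : rightTrace ul L x = ul := by
  cases L with
  | nil => rfl
  | cons a L => simp [rightTrace, h a (by simp)]

theorem leftTrace_map {ul : State} {L : List (K × State)} {f : K → K'} {x : K} {x' : K'}
    (h : ∀ a ∈ L, f a.1 < x' ↔ a.1 < x) :
    leftTrace ul (L.map (Prod.map f id)) x' = leftTrace ul L x := by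
  induction L generalizing ul with
  | nil => rfl
  | cons a L ih =>
    obtain ⟨y, u⟩ := a
    simp only [List.map_cons, Prod.map_apply, leftTrace, id, h (y, u) (by simp),
      ih fun a ha => h a (by simp [ha])]

theorem rightTrace_map {ul : State} {L : List (K × State)} {f : K → K'} {x : K} {x' : K'}
    (h : ∀ a ∈ L, x' < f a.1 ↔ x < a.1) :
    rightTrace ul (L.map (Prod.map f id)) x' = rightTrace ul L x := by
  induction L generalizing ul with
  | nil => rfl
  | cons a L ih =>
    obtain ⟨y, u⟩ := a
    simp only [List.map_cons, Prod.map_apply, rightTrace, id, h (y, u) (by simp),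
      ih fun a ha => h a (by simp [ha])]

theorem leftTrace_append_left {ul : State} {A B : List (K × State)} {x : K}
    (h : ∃ a ∈ A, x ≤ a.1) : leftTrace ul (A ++ B) x = leftTrace ul A x := by
  induction A generalizing ul with
  | nil => simp at h
  | cons a A ih =>
    obtain ⟨y, u⟩ := a
    simp only [List.cons_append, leftTrace]
    split_ifs with hy
    · refine ih ?_
      obtain ⟨a, ha, hx⟩ := h
      rcases List.mem_cons.1 ha with rfl | ha
      · exact absurd hy (not_lt.2 hx)
      · exact ⟨a, ha, hx⟩
    · rfl

theorem leftTrace_append_right {ul : State} {A B : List (K × State)} {x : K}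
    (h : ∀ a ∈ A, a.1 < x) : leftTrace ul (A ++ B) x = leftTrace (lastState ul A) B x := by
  induction A generalizing ul with
  | nil => rfl
  | cons a A ih =>
    obtain ⟨y, u⟩ := a
    simp only [List.cons_append, leftTrace, lastState, if_pos (h (y, u) (by simp)),
      ih fun a ha => h a (by simp [ha])]

theorem rightTrace_append_left {ul : State} {A B : List (K × State)} {x : K}
    (h : ∀ b ∈ B, x < b.1) : rightTrace ul (A ++ B) x = rightTrace ul A x := by
  induction A generalizing ul with
  | nil => exact rightTrace_eq_of_forall_lt h
  | cons a A ih =>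
    obtain ⟨y, u⟩ := a
    simp only [List.cons_append, rightTrace, ih]

theorem rightTrace_append_right {ul : State} {A B : List (K × State)} {x : K}
    (h : ∀ a ∈ A, a.1 ≤ x) : rightTrace ul (A ++ B) x = rightTrace (lastState ul A) B x := by
  induction A generalizing ul with
  | nil => rfl
  | cons a A ih =>
    obtain ⟨y, u⟩ := a
    simp only [List.cons_append, rightTrace, lastState, if_neg (not_lt.2 (h (y, u) (by simp))),
      ih fun a ha => h a (by simp [ha])]

/-- A jump crosses the set `F` if and only if the number of crossings with its key is odd. -/
theorem odd_count_crossings {F : Set State} {ul : State} {L : List (K × State)}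
    (hL : L.Pairwise fun a b => a.1 ≤ b.1) (x : K) :
    Odd ((crossings F ul L).count x) ↔
      ¬ (leftTrace ul L x ∈ F ↔ rightTrace ul L x ∈ F) := by
  induction L generalizing ul with
  | nil => simp [crossings, leftTrace, rightTrace]
  | cons a L ih =>
    obtain ⟨y, u⟩ := a
    obtain ⟨hy, hL⟩ := List.pairwise_cons.1 hL
    have ih := @ih u hL
    rcases lt_trichotomy y x with h | rfl | h
    · simp only [crossings, leftTrace, rightTrace, if_pos h, if_neg h.le.not_gt]
      split_ifs
      · exact ih
      · rw [List.count_cons_of_ne h.ne]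
        exact ih
    -- The first entry sits at the point itself. The tail then has left trace `u`, whereas the whole
    -- list has left trace `ul`; the crossing from `ul` to `u` accounts for the difference in
    -- parity.
    · rw [leftTrace_eq_of_forall_le (ul := u) hy] at ih
      simp only [crossings, leftTrace, rightTrace, lt_irrefl, if_false]
      split_ifs with hF
      · rw [ih, hF]
      · rw [List.count_cons_self, Nat.odd_add_one, ih]
        tauto
    · simp only [leftTrace, rightTrace, if_pos h, if_neg h.le.not_gt, iff_self, not_true, iff_false]
      rw [List.count_eq_zero_of_not_mem]
      · simp
      · intro hx
        obtain ⟨a, ha, rfl⟩ := exists_mem_of_mem_crossings hx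
        rcases List.mem_cons.1 ha with rfl | ha
        · exact lt_irrefl _ h
        · exact (hy a ha).not_gt h

theorem JumpsSatisfy.append {Q : State → State → Prop} {ul : State} {A B : List (K × State)}
    (hAB : ∀ a ∈ A, ∀ b ∈ B, a.1 < b.1) (hA : JumpsSatisfy Q ul A)
    (hB : JumpsSatisfy Q (lastState ul A) B) : JumpsSatisfy Q ul (A ++ B) := by
  intro a ha
  rcases List.mem_append.1 ha with ha | ha
  · rw [leftTrace_append_left ⟨a, ha, le_rfl⟩, rightTrace_append_left (hAB a ha)]
    exact hA a ha
  · rw [leftTrace_append_right fun c hc => hAB c hc a ha,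
      rightTrace_append_right fun c hc => (hAB c hc a ha).le]
    exact hB a ha

theorem JumpsSatisfy.map {Q : State → State → Prop} {ul : State} {L : List (K × State)}
    (hL : JumpsSatisfy Q ul L) {f : K → K'} (hf : StrictMono f) :
    JumpsSatisfy Q ul (L.map (Prod.map f id)) := by
  intro a ha
  obtain ⟨b, hb, rfl⟩ := List.mem_map.1 ha
  rw [Prod.map_fst, leftTrace_map (x := b.1) fun c _ => hf.lt_iff_lt,
    rightTrace_map (x := b.1) fun c _ => hf.lt_iff_lt]
  exact hL b hb

theorem JumpsSatisfy.mono {Q Q' : State → State → Prop} {ul : State} {L : List (K × State)}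
    (hL : JumpsSatisfy Q ul L)
    (h : ∀ a ∈ ul :: L.map Prod.snd, ∀ b ∈ ul :: L.map Prod.snd, Q a b → Q' a b) :
    JumpsSatisfy Q' ul L :=
  fun a ha => h _ (leftTrace_mem _ _ _) _ (rightTrace_mem _ _ _) (hL a ha)

/-- The traces at a key skip all intermediate states attached to that key, so a relation between
consecutive states would not suffice. -/
theorem jumpsSatisfy_of_pairwise {r : State → State → Prop} {ul : State} {L : List (K × State)}
    (hL : L.Pairwise fun a b => a.1 ≤ b.1) (hr : (ul :: L.map Prod.snd).Pairwise r) :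
    JumpsSatisfy r ul L := by
  induction L generalizing ul with
  | nil => simp [JumpsSatisfy]
  | cons a L ih =>
    obtain ⟨y, u⟩ := a
    obtain ⟨hy, hL⟩ := List.pairwise_cons.1 hL
    obtain ⟨hu, hr⟩ := List.pairwise_cons.1 hr
    have key : r (leftTrace ul ((y, u) :: L) y) (rightTrace ul ((y, u) :: L) y) := by
      simp only [leftTrace, rightTrace, lt_irrefl, if_false]
      exact hu _ (rightTrace_mem u L y)
    intro b hb
    rcases List.mem_cons.1 hb with rfl | hb
    · exact key
    · rcases (hy b hb).lt_or_eq with h | h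
      · simp only [leftTrace, rightTrace, if_pos h, if_neg h.le.not_gt]
        exact ih hL hr b hb
      · rw [← h]
        exact key

end Steps

/-! ### Points that occur an odd number of times in a list -/

section Count

variable {α : Type*} [DecidableEq α] (P : List α)

theorem setOf_odd_count_finite : {x | Odd (P.count x)}.Finite := by
  refine P.toFinset.finite_toSet.subset fun x hx => ?_
  by_contra h
  simp only [List.coe_toFinset, mem_ofPred_eq] at h hx
  simp [List.count_eq_zero_of_not_mem h] at hx

theorem ncard_odd_count : {x | Odd (P.count x)}.ncard = ∑ x ∈ P.toFinset, P.count x % 2 := by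
  have : {x | Odd (P.count x)} = ↑(P.toFinset.filter fun x => Odd (P.count x)) := by
    ext x
    simp only [mem_ofPred_eq, Finset.coe_filter, List.mem_toFinset, iff_and_self]
    intro hx
    by_contra h
    simp [List.count_eq_zero_of_not_mem h] at hx
  rw [this, ncard_coe_finset, Finset.card_filter]
  refine Finset.sum_congr rfl fun x _ => ?_
  split_ifs with h
  · exact (Nat.odd_iff.1 h).symm
  · exact (Nat.even_iff.1 (Nat.not_odd_iff_even.1 h)).symm

/-- Each value contributes its multiplicity `c = c % 2 + 2 * (c / 2)`. This is the source of the
parity statement, and of strict decrease as soon as some `c ≥ 2`. -/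
theorem length_eq_ncard_odd_count_add :
    P.length = {x | Odd (P.count x)}.ncard + 2 * ∑ x ∈ P.toFinset, P.count x / 2 := by
  rw [ncard_odd_count, Finset.mul_sum, ← Finset.sum_add_distrib,
    ← List.sum_toFinset_count_eq_length P]
  exact Finset.sum_congr rfl fun x _ => (Nat.mod_add_div _ _).symm

theorem ncard_odd_count_lt_length_iff :
    {x | Odd (P.count x)}.ncard < P.length ↔ ¬ P.Nodup := by
  have h := length_eq_ncard_odd_count_add P
  have : {x | Odd (P.count x)}.ncard < P.length ↔ ∑ x ∈ P.toFinset, P.count x / 2 ≠ 0 := by omega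
  rw [this, not_iff_not, Finset.sum_eq_zero_iff, List.nodup_iff_count_le_one]
  constructor
  · intro h x
    by_cases hx : x ∈ P
    · have := h x (List.mem_toFinset.2 hx)
      omega
    · simp [List.count_eq_zero_of_not_mem hx]
  · intro h x _
    have := h x
    omega

theorem odd_count_iff_mem_of_nodup {P : List α} (hP : P.Nodup) (x : α) :
    Odd (P.count x) ↔ x ∈ P := by
  by_cases hx : x ∈ P
  · simp [hx, List.count_eq_one_of_mem hP hx]
  · simp [hx, List.count_eq_zero_of_not_mem hx]

end Count

end TwoPhase

namespace TwoPhase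

/-! ### Traces of profiles -/

theorem profile_eventuallyEq_right (ul : State) (L : List (ℝ × State)) (x : ℝ) :
    ∀ᶠ z in 𝓝[>] x, profile ul L z = rightTrace ul L x := by
  induction L generalizing ul with
  | nil => exact Eventually.of_forall fun _ => rfl
  | cons a L ih =>
    obtain ⟨y, u⟩ := a
    by_cases h : x < y
    · filter_upwards [nhdsWithin_le_nhds (Iio_mem_nhds h)] with z hz
      simp only [profile, rightTrace, if_pos h, if_pos (mem_Iio.1 hz)]
    · filter_upwards [ih u, self_mem_nhdsWithin] with z hz hxz
      rw [profile, rightTrace, if_neg h, if_neg (not_lt.2 ((not_lt.1 h).trans (mem_Ioi.1 hxz).le)),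
        hz]

theorem profile_eventuallyEq_left (ul : State) (L : List (ℝ × State)) (x : ℝ) :
    ∀ᶠ z in 𝓝[<] x, profile ul L z = leftTrace ul L x := by
  induction L generalizing ul with
  | nil => exact Eventually.of_forall fun _ => rfl
  | cons a L ih =>
    obtain ⟨y, u⟩ := a
    by_cases h : y < x
    · filter_upwards [ih u, nhdsWithin_le_nhds (Ioi_mem_nhds h)] with z hz hyz
      rw [profile, leftTrace, if_pos h, if_neg (mem_Ioi.1 hyz).le.not_gt, hz]
    · filter_upwards [self_mem_nhdsWithin] with z hz
      simp only [profile, leftTrace, if_neg h, if_pos ((mem_Iio.1 hz).trans_le (not_lt.1 h))]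

theorem profile_tendsto_right (ul : State) (L : List (ℝ × State)) (x : ℝ) :
    Tendsto (profile ul L) (𝓝[>] x) (𝓝 (rightTrace ul L x)) :=
  tendsto_nhds_of_eventually_eq (profile_eventuallyEq_right ul L x)

theorem profile_tendsto_left (ul : State) (L : List (ℝ × State)) (x : ℝ) :
    Tendsto (profile ul L) (𝓝[<] x) (𝓝 (leftTrace ul L x)) :=
  tendsto_nhds_of_eventually_eq (profile_eventuallyEq_left ul L x)

theorem not_continuousAt_profile {ul : State} {L : List (ℝ × State)} {x : ℝ}
    (h : leftTrace ul L x ≠ rightTrace ul L x) : ¬ ContinuousAt (profile ul L) x := fun hc =>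
  h <| (tendsto_nhds_unique (profile_tendsto_left ul L x) (hc.mono_left nhdsWithin_le_nhds)).trans
    (tendsto_nhds_unique (profile_tendsto_right ul L x) (hc.mono_left nhdsWithin_le_nhds)).symm

/-- Among consecutive entries at one position `profile` reads the last, which is the one kept by
`collapse`. -/
theorem profile_collapse (ul : State) (L : List (ℝ × State)) (x : ℝ) :
    profile ul (collapse L) x = profile ul L x := by
  induction L generalizing ul with
  | nil => rfl
  | cons a L ih =>
    cases L with
    | nil => rfl
    | cons b L =>
      obtain ⟨y, u⟩ := a
      obtain ⟨y', u'⟩ := b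
      simp only [collapse]
      split_ifs with h
      · subst h
        rw [ih]
        simp only [profile]
        split_ifs <;> rfl
      · simp only [profile, ih]

theorem collapse_sublist (L : List (ℝ × State)) : (collapse L).Sublist L := by
  induction L with
  | nil => exact List.Sublist.refl _
  | cons a L ih =>
    cases L with
    | nil => exact List.Sublist.refl _
    | cons b L =>
      simp only [collapse]
      split_ifs
      · exact ih.cons _
      · exact ih.cons_cons _

theorem collapse_pairwise {L : List (ℝ × State)} (hL : L.Pairwise fun a b => a.1 ≤ b.1) :
    (collapse L).Pairwise fun a b => a.1 < b.1 := by
  induction L with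
  | nil => simp [collapse]
  | cons a L ih =>
    cases L with
    | nil => simp [collapse]
    | cons b L =>
      obtain ⟨ha, hL⟩ := List.pairwise_cons.1 hL
      simp only [collapse]
      split_ifs with h
      · exact ih hL
      · refine List.pairwise_cons.2 ⟨fun c hc => ?_, ih hL⟩
        have hab : a.1 < b.1 := lt_of_le_of_ne (ha b (by simp)) h
        rcases List.mem_cons.1 ((collapse_sublist _).subset hc) with rfl | hc
        · exact hab
        · exact hab.trans_le ((List.pairwise_cons.1 hL).1 c hc)

/-! ### Wave-fronts keyed by their origin and their speed -/

/-- The fronts, keyed by their initial position and their speed. -/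
noncomputable def keyed : State → List (ℝ × State) → List ((ℝ ×ₗ ℝ) × State)
  | _, [] => []
  | ul, (y, u) :: L => (toLex (y, sigma ul u), u) :: keyed u L

/-- The position after time `s` of the front with a given initial position and speed. -/
def position (s : ℝ) (k : ℝ ×ₗ ℝ) : ℝ := (ofLex k).1 + (ofLex k).2 * s

theorem evolve_eq (ul : State) (L : List (ℝ × State)) (s : ℝ) :
    evolve ul L s = (keyed ul L).map (Prod.map (position s) id) := by
  induction L generalizing ul with
  | nil => rfl
  | cons a L ih => simp [evolve, keyed, position, ih]

theorem keyed_map_snd (ul : State) (L : List (ℝ × State)) :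
    (keyed ul L).map Prod.snd = L.map Prod.snd := by
  induction L generalizing ul with
  | nil => rfl
  | cons a L ih => simp [keyed, ih]

theorem evolve_map_snd (ul : State) (L : List (ℝ × State)) (s : ℝ) :
    (evolve ul L s).map Prod.snd = L.map Prod.snd := by
  rw [evolve_eq, ← keyed_map_snd ul L, List.map_map]
  rfl

theorem continuous_position (k : ℝ ×ₗ ℝ) : Continuous fun s => position s k := by
  unfold position
  fun_prop

section Fronts

variable {ul : State} {L : List (ℝ × State)}

/-- Two neighbours that approach each other have not met before time `s`; two that do not approach
keep the order of their origins. -/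
theorem keyed_isChain_position (hL : (keyed ul L).Pairwise fun a b => a.1 ≤ b.1) {s : ℝ}
    (hs0 : 0 ≤ s) (hs : ∀ m ∈ meetTimes ul L, s ≤ m) :
    (keyed ul L).IsChain fun a b => position s a.1 ≤ position s b.1 := by
  induction L generalizing ul with
  | nil => simp [keyed]
  | cons a L ih =>
    cases L with
    | nil => simp [keyed]
    | cons b L =>
      obtain ⟨y, u⟩ := a
      obtain ⟨y', u'⟩ := b
      obtain ⟨ha, hL⟩ := List.pairwise_cons.1 hL
      have hab := ha (toLex (y', sigma u u'), u') (by simp [keyed])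
      have hs' : ∀ m ∈ meetTimes u ((y', u') :: L), s ≤ m := by
        intro m hm
        refine hs m ?_
        rw [meetTimes]
        split_ifs
        · exact List.mem_cons_of_mem _ hm
        · exact hm
      have := ih hL hs'
      simp only [keyed] at this ⊢
      refine List.isChain_cons_cons.2 ⟨?_, this⟩
      simp only [Prod.Lex.le_iff, ofLex_toLex] at hab
      simp only [position, ofLex_toLex]
      by_cases h : sigma u u' < sigma ul u
      · have hm := hs ((y' - y) / (sigma ul u - sigma u u')) (by rw [meetTimes, if_pos h]; simp)
        rw [le_div_iff₀ (by linarith)] at hm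
        linarith
      · have := mul_le_mul_of_nonneg_right (not_lt.1 h) hs0
        rcases hab with hab | hab
        · linarith
        · linarith [hab.1]

/-- Fronts with a common origin have nondecreasing speeds, so approaching neighbours start at a
positive distance. This is why the interaction times increase strictly. -/
theorem meetTimes_pos (hL : (keyed ul L).Pairwise fun a b => a.1 ≤ b.1) :
    ∀ m ∈ meetTimes ul L, 0 < m := by
  induction L generalizing ul with
  | nil => simp [meetTimes]
  | cons a L ih =>
    cases L with
    | nil => simp [meetTimes]
    | cons b L =>
      obtain ⟨y, u⟩ := a
      obtain ⟨y', u'⟩ := b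
      obtain ⟨ha, hL⟩ := List.pairwise_cons.1 hL
      have hab := ha (toLex (y', sigma u u'), u') (by simp [keyed])
      simp only [Prod.Lex.le_iff, ofLex_toLex] at hab
      have ih := ih hL
      rw [meetTimes]
      split_ifs with h
      · intro m hm
        rcases List.mem_cons.1 hm with rfl | hm
        · rcases hab with hab | hab
          · exact div_pos (by linarith) (by linarith)
          · exact absurd h (not_lt.2 hab.2)
        · exact ih m hm
      · exact ih

theorem minimum_meetTimes_pos (hL : (keyed ul L).Pairwise fun a b => a.1 ≤ b.1) :
    (0 : WithTop ℝ) < (meetTimes ul L).minimum := by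
  cases h : (meetTimes ul L).minimum with
  | top => exact WithTop.coe_lt_top 0
  | coe m => exact WithTop.coe_lt_coe.2 (meetTimes_pos hL m (List.minimum_mem h))

theorem position_pairwise (hL : (keyed ul L).Pairwise fun a b => a.1 ≤ b.1) {s : ℝ}
    (hs0 : 0 ≤ s) (hs : (s : WithTop ℝ) ≤ (meetTimes ul L).minimum) :
    (keyed ul L).Pairwise fun a b => position s a.1 ≤ position s b.1 := by
  have : IsTrans ((ℝ ×ₗ ℝ) × State) fun a b => position s a.1 ≤ position s b.1 :=
    ⟨fun _ _ _ => le_trans⟩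
  exact List.isChain_iff_pairwise.1 (keyed_isChain_position hL hs0 fun m hm =>
    WithTop.coe_le_coe.1 (hs.trans (List.minimum_le_of_mem' hm)))

theorem evolve_pairwise (hL : (keyed ul L).Pairwise fun a b => a.1 ≤ b.1) {s : ℝ}
    (hs0 : 0 ≤ s) (hs : (s : WithTop ℝ) ≤ (meetTimes ul L).minimum) :
    (evolve ul L s).Pairwise fun a b => a.1 ≤ b.1 := by
  rw [evolve_eq, List.pairwise_map]
  exact position_pairwise hL hs0 hs

theorem position_mono (hL : (keyed ul L).Pairwise fun a b => a.1 ≤ b.1) {s : ℝ}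
    (hs0 : 0 ≤ s) (hs : (s : WithTop ℝ) ≤ (meetTimes ul L).minimum)
    {a b : (ℝ ×ₗ ℝ) × State} (ha : a ∈ keyed ul L) (hb : b ∈ keyed ul L) (hab : a.1 ≤ b.1) :
    position s a.1 ≤ position s b.1 := by
  have h := hL.and (position_pairwise hL hs0 hs)
  -- If the two entries occur in the opposite order in the list, their keys are equal, and so are
  -- their positions.
  exact List.Pairwise.forall_of_forall_of_flip
    (R := fun a b => a.1 ≤ b.1 → position s a.1 ≤ position s b.1) (fun _ _ _ => le_rfl)
    (h.imp fun h _ => h.2) (h.imp fun {a b} h h' => by rw [le_antisymm h' h.1]) ha hb hab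

theorem position_strictMono (hL : (keyed ul L).Pairwise fun a b => a.1 ≤ b.1) {s : ℝ}
    (hs0 : 0 < s) (hs : (s : WithTop ℝ) < (meetTimes ul L).minimum)
    {a b : (ℝ ×ₗ ℝ) × State} (ha : a ∈ keyed ul L) (hb : b ∈ keyed ul L) (hab : a.1 < b.1) :
    position s a.1 < position s b.1 := by
  -- Lines from different origins that coincided at `s` would be in the wrong order at any later
  -- time `r`, where the weak order still holds.
  obtain ⟨r, hsr, hr⟩ : ∃ r : ℝ, s < r ∧ (r : WithTop ℝ) ≤ (meetTimes ul L).minimum := by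
    cases h : (meetTimes ul L).minimum with
    | top => exact ⟨s + 1, by linarith, le_top⟩
    | coe m =>
      rw [h] at hs
      exact ⟨m, WithTop.coe_lt_coe.1 hs, le_rfl⟩
  have h := position_mono hL (hs0.trans hsr).le hr ha hb hab.le
  rw [Prod.Lex.lt_iff] at hab
  simp only [position] at h ⊢
  rcases hab with h0 | ⟨h0, h1⟩
  · nlinarith
  · rw [h0]
    linarith [mul_lt_mul_of_pos_right h1 hs0]

end Fronts

end TwoPhase

/-! ### Phase transitions of step functions and of evolving fronts -/

namespace TwoPhase

namespace Model

variable (M : Model)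

/-- The states differ, and a change of phase is one of the admissible phase transitions. -/
def AdmissibleJump (a b : State) : Prop :=
  a ≠ b ∧ (¬ (a ∈ M.Omegaf ↔ b ∈ M.Omegaf) → (a, b) ∈ M.Ge)

theorem antitoneOn_vf : AntitoneOn M.vf (Icc 0 M.Rf₂) := by
  refine antitoneOn_of_deriv_nonpos (convex_Icc _ _) M.vf_contDiff.continuousOn
    ((M.vf_contDiff.differentiableOn (by norm_num)).mono interior_subset) fun x hx => ?_
  rw [← derivWithin_of_mem_nhds (mem_interior_iff_mem_nhds.1 hx)]
  exact M.vf_deriv x (interior_subset hx)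

theorem Rf₂_pos : 0 < M.Rf₂ := M.Rf₁_pos.trans M.Rf₁_lt

theorem Vf_le_of_mem_Omegaf {u : State} (hu : u ∈ M.Omegaf) : M.Vf ≤ u.2 := hu.2.1.1

theorem le_Vc_of_mem_Omegac {u : State} (hu : u ∈ M.Omegac) : u.2 ≤ M.Vc := hu.2.1.2

theorem notMem_Omegaf_of_mem_Omegac {u : State} (hu : u ∈ M.Omegac) : u ∉ M.Omegaf := fun h =>
  absurd ((M.Vf_le_of_mem_Omegaf h).trans (M.le_Vc_of_mem_Omegac hu)) (not_le.2 M.Vc_lt)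

theorem mem_Omegac_iff_notMem {u : State} (hu : u ∈ M.Omega) : u ∈ M.Omegac ↔ u ∉ M.Omegaf :=
  ⟨M.notMem_Omegaf_of_mem_Omegac, fun h => hu.resolve_left h⟩

variable {M} in
-- One-sided limits are unique, and the gap between `Vc` and `Vf` makes the two phases a partition
-- of `Omega`.
theorem isPhaseTransition_profile {ul : State} {L : List (ℝ × State)} {x : ℝ} {um up : State}
    (hΩ : ∀ u ∈ ul :: L.map Prod.snd, u ∈ M.Omega) :
    M.IsPhaseTransition (profile ul L) x um up ↔ um = leftTrace ul L x ∧ up = rightTrace ul L x ∧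
      ¬ (leftTrace ul L x ∈ M.Omegaf ↔ rightTrace ul L x ∈ M.Omegaf) := by
  have h1 := M.mem_Omegac_iff_notMem (hΩ _ (leftTrace_mem ul L x))
  have h2 := M.mem_Omegac_iff_notMem (hΩ _ (rightTrace_mem ul L x))
  constructor
  · rintro ⟨hl, hr, h⟩
    obtain rfl := tendsto_nhds_unique hl (profile_tendsto_left ul L x)
    obtain rfl := tendsto_nhds_unique hr (profile_tendsto_right ul L x)
    refine ⟨rfl, rfl, ?_⟩
    rw [h1, h2] at h
    tauto
  · rintro ⟨rfl, rfl, h⟩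
    refine ⟨profile_tendsto_left ul L x, profile_tendsto_right ul L x, ?_⟩
    rw [h1, h2]
    tauto

variable {M} in
theorem phaseTransitions_profile {ul : State} {L : List (ℝ × State)}
    (hΩ : ∀ u ∈ ul :: L.map Prod.snd, u ∈ M.Omega) (hL : L.Pairwise fun a b => a.1 ≤ b.1) :
    M.phaseTransitions (profile ul L) = {x | Odd ((crossings M.Omegaf ul L).count x)} := by
  ext x
  simp only [phaseTransitions, mem_ofPred_eq, isPhaseTransition_profile hΩ, odd_count_crossings hL]
  exact ⟨fun ⟨_, _, _, _, h⟩ => h, fun h => ⟨_, _, rfl, rfl, h⟩⟩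

variable {M} in
theorem numPT_profile_of_pairwise_lt {ul : State} {L : List (ℝ × State)}
    (hΩ : ∀ u ∈ ul :: L.map Prod.snd, u ∈ M.Omega) (hL : L.Pairwise fun a b => a.1 < b.1) :
    M.numPT (profile ul L) = (crossings M.Omegaf ul L).length := by
  have hnd : (crossings M.Omegaf ul L).Nodup :=
    List.Nodup.sublist (crossings_sublist _ _ _) ((List.pairwise_map.2 hL).imp fun h => h.ne)
  rw [numPT, phaseTransitions_profile hΩ (hL.imp fun h => h.le)]
  have h1 := length_eq_ncard_odd_count_add (crossings M.Omegaf ul L)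
  have h2 := (ncard_odd_count_lt_length_iff (crossings M.Omegaf ul L)).not_left.2 hnd
  omega

/-! ### Fronts issuing from solved Riemann problems -/

/-- The properties of the fronts produced by the Riemann solver. -/
structure IsResolved (ul : State) (L : List (ℝ × State)) : Prop where
  mem_Omega : ∀ u ∈ ul :: L.map Prod.snd, u ∈ M.Omega
  pairwise_le : (keyed ul L).Pairwise fun a b => a.1 ≤ b.1
  admissible : JumpsSatisfy M.AdmissibleJump ul (keyed ul L)
  nodup : (crossings M.Omegaf ul (keyed ul L)).Nodup

namespace IsResolved

variable {M} {ul : State} {L : List (ℝ × State)} (h : M.IsResolved ul L)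
include h

theorem evolve_mem_Omega (s : ℝ) : ∀ u ∈ ul :: (evolve ul L s).map Prod.snd, u ∈ M.Omega := by
  rw [evolve_map_snd]
  exact h.mem_Omega

theorem phaseTransitions_evolve {s : ℝ} (hs0 : 0 ≤ s)
    (hs : (s : WithTop ℝ) ≤ (meetTimes ul L).minimum) :
    M.phaseTransitions (profile ul (evolve ul L s)) =
      {x | Odd (((crossings M.Omegaf ul (keyed ul L)).map (position s)).count x)} := by
  rw [phaseTransitions_profile (h.evolve_mem_Omega s) (evolve_pairwise h.pairwise_le hs0 hs),
    evolve_eq, crossings_map]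

/-- Distinct keys have distinct positions strictly before the meeting time, and `nodup` excludes two
crossings with the same key, which would travel together and cancel. -/
theorem nodup_map_position {s : ℝ} (hs0 : 0 < s)
    (hs : (s : WithTop ℝ) < (meetTimes ul L).minimum) :
    ((crossings M.Omegaf ul (keyed ul L)).map (position s)).Nodup := by
  refine List.Nodup.map_on (fun k hk k' hk' hkk' => ?_) h.nodup
  obtain ⟨a, ha, rfl⟩ := exists_mem_of_mem_crossings hk
  obtain ⟨b, hb, rfl⟩ := exists_mem_of_mem_crossings hk'
  rcases lt_trichotomy a.1 b.1 with hab | hab | hab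
  · exact absurd hkk' (position_strictMono h.pairwise_le hs0 hs ha hb hab).ne
  · exact hab
  · exact absurd hkk' (position_strictMono h.pairwise_le hs0 hs hb ha hab).ne'

theorem mem_phaseTransitions_evolve {s : ℝ} (hs0 : 0 < s)
    (hs : (s : WithTop ℝ) < (meetTimes ul L).minimum) (x : ℝ) :
    x ∈ M.phaseTransitions (profile ul (evolve ul L s)) ↔
      ∃ k ∈ crossings M.Omegaf ul (keyed ul L), position s k = x := by
  rw [h.phaseTransitions_evolve hs0.le hs.le, mem_ofPred_eq,
    odd_count_iff_mem_of_nodup (h.nodup_map_position hs0 hs), List.mem_map]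

theorem finite_phaseTransitions {s : ℝ} (hs0 : 0 ≤ s)
    (hs : (s : WithTop ℝ) ≤ (meetTimes ul L).minimum) :
    (M.phaseTransitions (profile ul (evolve ul L s))).Finite := by
  rw [h.phaseTransitions_evolve hs0 hs]
  exact setOf_odd_count_finite _

theorem exists_length_eq {s : ℝ} (hs0 : 0 ≤ s)
    (hs : (s : WithTop ℝ) ≤ (meetTimes ul L).minimum) :
    ∃ m, (crossings M.Omegaf ul (keyed ul L)).length =
      M.numPT (profile ul (evolve ul L s)) + 2 * m := by
  have := length_eq_ncard_odd_count_add
    ((crossings M.Omegaf ul (keyed ul L)).map (position s))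
  rw [List.length_map] at this
  exact ⟨_, by rw [numPT, h.phaseTransitions_evolve hs0 hs]; exact this⟩

theorem numPT_lt_length_iff {s : ℝ} (hs0 : 0 ≤ s)
    (hs : (s : WithTop ℝ) ≤ (meetTimes ul L).minimum) :
    M.numPT (profile ul (evolve ul L s)) < (crossings M.Omegaf ul (keyed ul L)).length ↔
      ¬ ((crossings M.Omegaf ul (keyed ul L)).map (position s)).Nodup := by
  rw [← ncard_odd_count_lt_length_iff, List.length_map, numPT, h.phaseTransitions_evolve hs0 hs]

theorem numPT_eq_length {s : ℝ} (hs0 : 0 < s)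
    (hs : (s : WithTop ℝ) < (meetTimes ul L).minimum) :
    M.numPT (profile ul (evolve ul L s)) = (crossings M.Omegaf ul (keyed ul L)).length := by
  obtain ⟨m, hm⟩ := h.exists_length_eq hs0.le hs.le
  have := (h.numPT_lt_length_iff hs0.le hs.le).not.2 (not_not.2 (h.nodup_map_position hs0 hs))
  omega

/-- A jump to which a single bundle of fronts contributes is admissible. -/
theorem admissibleJump_evolve {s : ℝ} (hs0 : 0 ≤ s)
    (hs : (s : WithTop ℝ) ≤ (meetTimes ul L).minimum) {a : (ℝ ×ₗ ℝ) × State}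
    (ha : a ∈ keyed ul L)
    (hx : ∀ b ∈ keyed ul L, position s b.1 = position s a.1 → b.1 = a.1) :
    M.AdmissibleJump (leftTrace ul (evolve ul L s) (position s a.1))
      (rightTrace ul (evolve ul L s) (position s a.1)) := by
  rw [evolve_eq, leftTrace_map (x := a.1), rightTrace_map (x := a.1)]
  · exact h.admissible a ha
  · refine fun b hb => ⟨fun hlt => ?_, fun hlt => ?_⟩
    · by_contra hle
      exact (position_mono h.pairwise_le hs0 hs hb ha (not_lt.1 hle)).not_gt hlt
    · exact lt_of_le_of_ne (position_mono h.pairwise_le hs0 hs ha hb hlt.le) fun he =>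
        hlt.ne' (hx b hb he.symm)
  · refine fun b hb => ⟨fun hlt => ?_, fun hlt => ?_⟩
    · by_contra hle
      exact (position_mono h.pairwise_le hs0 hs ha hb (not_lt.1 hle)).not_gt hlt
    · exact lt_of_le_of_ne (position_mono h.pairwise_le hs0 hs hb ha hlt.le) fun he =>
        hlt.ne (hx b hb he)

theorem not_continuousAt_evolve {s : ℝ} (hs0 : 0 < s)
    (hs : (s : WithTop ℝ) < (meetTimes ul L).minimum) {a : (ℝ ×ₗ ℝ) × State}
    (ha : a ∈ keyed ul L) :
    ¬ ContinuousAt (profile ul (evolve ul L s)) (position s a.1) := by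
  refine not_continuousAt_profile (h.admissibleJump_evolve hs0.le hs.le ha fun b hb he => ?_).1
  rcases lt_trichotomy a.1 b.1 with hab | hab | hab
  · exact absurd he (position_strictMono h.pairwise_le hs0 hs ha hb hab).ne'
  · exact hab.symm
  · exact absurd he (position_strictMono h.pairwise_le hs0 hs hb ha hab).ne

/-- If all fronts at `x` share one key, the traces at `x` are the traces at that key, where
admissibility is known. Otherwise two different keys have met. -/
theorem mem_Ge_or_exists_lt {s : ℝ} (hs0 : 0 ≤ s)
    (hs : (s : WithTop ℝ) ≤ (meetTimes ul L).minimum) {x : ℝ} {um up : State}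
    (hx : M.IsPhaseTransition (profile ul (evolve ul L s)) x um up) :
    (um, up) ∈ M.Ge ∨ ∃ a ∈ keyed ul L, ∃ b ∈ keyed ul L, a.1 < b.1 ∧
      position s a.1 = x ∧ position s b.1 = x := by
  have hΩ := h.evolve_mem_Omega s
  obtain ⟨rfl, rfl, hF⟩ := (isPhaseTransition_profile hΩ).1 hx
  have hmem : x ∈ M.phaseTransitions (profile ul (evolve ul L s)) := ⟨_, _, hx⟩
  rw [h.phaseTransitions_evolve hs0 hs] at hmem
  have hmem' := List.count_pos_iff.1 (Odd.pos hmem)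
  obtain ⟨k, hk, rfl⟩ := List.mem_map.1 hmem'
  obtain ⟨a, ha, rfl⟩ := exists_mem_of_mem_crossings hk
  by_cases hu : ∀ b ∈ keyed ul L, position s b.1 = position s a.1 → b.1 = a.1
  · exact Or.inl ((h.admissibleJump_evolve hs0 hs ha hu).2 hF)
  · push Not at hu
    obtain ⟨b, hb, he, hne⟩ := hu
    rcases hne.lt_or_gt with hlt | hlt
    · exact Or.inr ⟨b, hb, a, ha, hlt, he, rfl⟩
    · exact Or.inr ⟨a, ha, b, hb, hlt, rfl, he⟩

end IsResolved

end Model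

end TwoPhase

namespace TwoPhase

/-! ### Calculus for the map `x ↦ x * f x` -/

section Calculus

variable {f : ℝ → ℝ} {s : Set ℝ} {x : ℝ}

theorem hasDerivAt_of_contDiffOn (hf : ContDiffOn ℝ 2 f s) (hx : x ∈ interior s) :
    HasDerivAt f (derivWithin f s x) x :=
  ((hf.differentiableOn (by norm_num) x (interior_subset hx)).hasDerivWithinAt).hasDerivAt
    (mem_interior_iff_mem_nhds.1 hx)

theorem hasDerivAt_derivWithin_of_contDiffOn (hs : UniqueDiffOn ℝ s) (hf : ContDiffOn ℝ 2 f s)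
    (hx : x ∈ interior s) :
    HasDerivAt (derivWithin f s) (iteratedDerivWithin 2 f s x) x := by
  have h1 : ContDiffOn ℝ 1 (derivWithin f s) s := hf.derivWithin hs (by norm_num)
  have h2 : iteratedDerivWithin 2 f s x = derivWithin (derivWithin f s) s x := by
    rw [iteratedDerivWithin_succ, iteratedDerivWithin_one]
  rw [h2]
  exact (h1.differentiableOn_one x (interior_subset hx)).hasDerivWithinAt.hasDerivAt
    (mem_interior_iff_mem_nhds.1 hx)

theorem hasDerivAt_mul_self (hf : ContDiffOn ℝ 2 f s) (hx : x ∈ interior s) :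
    HasDerivAt (fun y => y * f y) (f x + x * derivWithin f s x) x := by
  have h : HasDerivAt (fun y => y * f y) (1 * f x + x * derivWithin f s x) x :=
    (hasDerivAt_id x).mul (hasDerivAt_of_contDiffOn hf hx)
  rwa [one_mul] at h

theorem hasDerivAt_deriv_mul_self (hs : UniqueDiffOn ℝ s) (hf : ContDiffOn ℝ 2 f s)
    (hx : x ∈ interior s) :
    HasDerivAt (deriv fun y => y * f y)
      (2 * derivWithin f s x + x * iteratedDerivWithin 2 f s x) x := by
  have h1 : HasDerivAt (fun y => f y + y * derivWithin f s y)
      (derivWithin f s x + (1 * derivWithin f s x + x * iteratedDerivWithin 2 f s x)) x :=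
    (hasDerivAt_of_contDiffOn hf hx).add
      ((hasDerivAt_id x).mul (hasDerivAt_derivWithin_of_contDiffOn hs hf hx))
  have h2 : (deriv fun y => y * f y) =ᶠ[𝓝 x] fun y => f y + y * derivWithin f s y := by
    filter_upwards [isOpen_interior.mem_nhds hx] with y hy
    exact (hasDerivAt_mul_self hf hy).deriv
  rw [show 2 * derivWithin f s x + x * iteratedDerivWithin 2 f s x = derivWithin f s x +
    (1 * derivWithin f s x + x * iteratedDerivWithin 2 f s x) by ring]
  exact h1.congr_of_eventuallyEq h2

end Calculus

namespace Model

variable (M : Model)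

/-- Chord slopes of this flux are the speeds of free fronts, so concavity orders a discretized
rarefaction. The order is only weak, since the flux may be affine on an interval. -/
theorem concaveOn_free_flux : ConcaveOn ℝ (Icc 0 M.Rf₂) fun ρ => ρ * M.vf ρ := by
  have hs := uniqueDiffOn_Icc M.Rf₂_pos
  refine concaveOn_of_deriv2_nonpos (convex_Icc _ _)
    (continuousOn_id.mul M.vf_contDiff.continuousOn)
    (fun x hx => (hasDerivAt_mul_self M.vf_contDiff hx).differentiableAt.differentiableWithinAt)
    (fun x hx =>
      (hasDerivAt_deriv_mul_self hs M.vf_contDiff hx).differentiableAt.differentiableWithinAt)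
    fun x hx => ?_
  have := (hasDerivAt_deriv_mul_self hs M.vf_contDiff hx).deriv
  simp only [Function.iterate_succ, Function.iterate_zero, Function.comp, id]
  rw [this]
  exact M.vf_concave x (interior_subset hx)

theorem strictMonoOn_free_flux : StrictMonoOn (fun ρ => ρ * M.vf ρ) (Icc 0 M.Rf₂) := by
  refine strictMonoOn_of_deriv_pos (convex_Icc _ _)
    (continuousOn_id.mul M.vf_contDiff.continuousOn) fun x hx => ?_
  rw [(hasDerivAt_mul_self M.vf_contDiff hx).deriv]
  exact M.vf_flux x (interior_subset hx)

theorem strictConvexOn_mul_p : StrictConvexOn ℝ (Ici M.Rf₁) fun ρ => ρ * M.p ρ := by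
  have hs := uniqueDiffOn_Ici M.Rf₁
  refine strictConvexOn_of_deriv2_pos (convex_Ici _)
    (continuousOn_id.mul M.p_contDiff.continuousOn) fun x hx => ?_
  have := (hasDerivAt_deriv_mul_self hs M.p_contDiff hx).deriv
  simp only [Function.iterate_succ, Function.iterate_zero, Function.comp, id]
  rw [this]
  exact M.p_convex x (interior_subset hx)

theorem strictMonoOn_p : StrictMonoOn M.p (Ici M.Rf₁) := by
  refine strictMonoOn_of_deriv_pos (convex_Ici _) M.p_contDiff.continuousOn fun x hx => ?_
  rw [(hasDerivAt_of_contDiffOn M.p_contDiff hx).deriv]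
  exact M.p_deriv x (interior_subset hx)

theorem Vc_lt_vf {ρ : ℝ} (hρ : ρ ∈ Icc 0 M.Rf₂) : M.Vc < M.vf ρ :=
  M.Vc_lt.trans_le (M.antitoneOn_vf hρ (right_mem_Icc.2 M.Rf₂_pos.le) hρ.2)

/-! ### States and their Riemann invariants -/

theorem mk_mem_Omegaf {ρ : ℝ} (hρ : ρ ∈ Icc 0 M.Rf₂) : (ρ, M.vf ρ) ∈ M.Omegaf :=
  ⟨hρ, ⟨M.antitoneOn_vf hρ (right_mem_Icc.2 M.Rf₂_pos.le) hρ.2,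
    M.antitoneOn_vf (left_mem_Icc.2 M.Rf₂_pos.le) hρ hρ.1⟩, rfl⟩

theorem Icc_Rf_subset : Icc M.Rf₁ M.Rf₂ ⊆ Icc 0 M.Rf₂ := Icc_subset_Icc_left M.Rf₁_pos.le

theorem Rf₁_mem : M.Rf₁ ∈ Icc 0 M.Rf₂ := ⟨M.Rf₁_pos.le, M.Rf₁_lt.le⟩

variable {M}

theorem Vc_lt_of_mem_Omegaf {u : State} (hu : u ∈ M.Omegaf) : M.Vc < u.2 :=
  M.Vc_lt.trans_le hu.2.1.1

theorem ext_of_mem_Omegaf {a b : State} (ha : a ∈ M.Omegaf) (hb : b ∈ M.Omegaf)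
    (h : a.1 = b.1) : a = b :=
  Prod.ext h (by rw [ha.2.2, hb.2.2, h])

theorem w2_of_mem_Omegac {u : State} (hu : u ∈ M.Omegac) : M.w2 u = u.2 + M.p u.1 :=
  if_neg fun h => M.notMem_Omegaf_of_mem_Omegac hu h.1

theorem w2_of_mem_Omegaf₁ {u : State} (hu : u ∈ M.Omegaf₁) :
    M.w2 u = M.Wc + M.vf M.Rf₁ - M.vf u.1 := if_pos hu

theorem w2_of_mem_Omegaf₂ {u : State} (hu : u ∈ M.Omegaf₂) : M.w2 u = u.2 + M.p u.1 :=
  if_neg fun h => hu.2.not_gt h.2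

theorem w2_le_Wc_of_mem_Omegaf₁ {u : State} (hu : u ∈ M.Omegaf₁) : M.w2 u ≤ M.Wc := by
  rw [w2_of_mem_Omegaf₁ hu]
  linarith [M.antitoneOn_vf hu.1.1 M.Rf₁_mem hu.2.le]

theorem Wc_le_w2_of_mem_Omegaf₂ {u : State} (hu : u ∈ M.Omegaf₂) : M.Wc ≤ M.w2 u := by
  rw [w2_of_mem_Omegaf₂ hu, hu.1.2.2, Wc, add_comm]
  exact M.vf_add_p.monotoneOn (left_mem_Icc.2 M.Rf₁_lt.le) ⟨hu.2, hu.1.1.2⟩ hu.2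

theorem Wc_le_Wmax : M.Wc ≤ M.Wmax := by
  have := M.vf_add_p.monotoneOn (left_mem_Icc.2 M.Rf₁_lt.le) (right_mem_Icc.2 M.Rf₁_lt.le)
    M.Rf₁_lt.le
  simp only [Wc, Wmax, Vf] at this ⊢
  linarith

theorem w2_le_Wmax_of_mem_Omegaf {u : State} (hu : u ∈ M.Omegaf) : M.w2 u ≤ M.Wmax := by
  by_cases h : u.1 < M.Rf₁
  · exact (w2_le_Wc_of_mem_Omegaf₁ ⟨hu, h⟩).trans Wc_le_Wmax
  · have hu2 : u ∈ M.Omegaf₂ := ⟨hu, not_lt.1 h⟩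
    rw [w2_of_mem_Omegaf₂ hu2, hu.2.2, Wmax, Vf, add_comm (M.p M.Rf₂)]
    exact M.vf_add_p.monotoneOn ⟨hu2.2, hu.1.2⟩ (right_mem_Icc.2 M.Rf₁_lt.le) hu.1.2

/-- The two branches of `w2` are separated by the value `Wc`. Strictness fails where `vf` is
constant below `Rf₁`. -/
theorem w2_mono_of_mem_Omegaf {a b : State} (ha : a ∈ M.Omegaf) (hb : b ∈ M.Omegaf)
    (h : a.1 ≤ b.1) : M.w2 a ≤ M.w2 b := by
  by_cases hb1 : b.1 < M.Rf₁
  · rw [w2_of_mem_Omegaf₁ ⟨ha, h.trans_lt hb1⟩, w2_of_mem_Omegaf₁ ⟨hb, hb1⟩]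
    linarith [M.antitoneOn_vf ha.1 hb.1 h]
  · have hb2 : b ∈ M.Omegaf₂ := ⟨hb, not_lt.1 hb1⟩
    by_cases ha1 : a.1 < M.Rf₁
    · exact (w2_le_Wc_of_mem_Omegaf₁ ⟨ha, ha1⟩).trans (Wc_le_w2_of_mem_Omegaf₂ hb2)
    · have ha2 : a ∈ M.Omegaf₂ := ⟨ha, not_lt.1 ha1⟩
      rw [w2_of_mem_Omegaf₂ ha2, w2_of_mem_Omegaf₂ hb2, ha.2.2, hb.2.2]
      exact M.vf_add_p.monotoneOn ⟨ha2.2, ha.1.2⟩ ⟨hb2.2, hb.1.2⟩ h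

theorem lt_of_w2_lt {a b : State} (ha : a ∈ M.Omegaf) (hb : b ∈ M.Omegaf)
    (h : M.w2 a < M.w2 b) : a.1 < b.1 :=
  not_le.1 fun h' => (w2_mono_of_mem_Omegaf hb ha h').not_gt h

theorem rhof_spec {w : ℝ} (hw : w ∈ Icc M.Wc M.Wmax) :
    M.rhof w ∈ Icc M.Rf₁ M.Rf₂ ∧ M.vf (M.rhof w) + M.p (M.rhof w) = w := by
  refine Function.invFunOn_pos (f := fun ρ => M.vf ρ + M.p ρ) ?_
  have hc : ContinuousOn (fun ρ => M.vf ρ + M.p ρ) (Icc M.Rf₁ M.Rf₂) :=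
    (M.vf_contDiff.continuousOn.mono M.Icc_Rf_subset).add
      (M.p_contDiff.continuousOn.mono Icc_subset_Ici_self)
  have := intermediate_value_Icc M.Rf₁_lt.le hc
  refine this ⟨?_, ?_⟩
  · simpa only [Wc, add_comm] using hw.1
  · simpa only [Wmax, Vf, add_comm] using hw.2

theorem mk_rhof_mem {w : ℝ} (hw : w ∈ Icc M.Wc M.Wmax) :
    (M.rhof w, M.vf (M.rhof w)) ∈ M.Omegaf₂ :=
  ⟨M.mk_mem_Omegaf (M.Icc_Rf_subset (rhof_spec hw).1), (rhof_spec hw).1.1⟩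

theorem w2_mk_rhof {w : ℝ} (hw : w ∈ Icc M.Wc M.Wmax) :
    M.w2 (M.rhof w, M.vf (M.rhof w)) = w := by
  rw [w2_of_mem_Omegaf₂ (mk_rhof_mem hw)]
  exact (rhof_spec hw).2

theorem freeState_spec {w : ℝ} (hw : w ∈ Icc M.Wmin M.Wmax) :
    M.freeState w ∈ M.Omegaf ∧ M.w2 (M.freeState w) = w := by
  refine Function.invFunOn_pos ?_
  rcases le_total M.Wc w with h | h
  · exact ⟨_, (mk_rhof_mem ⟨h, hw.2⟩).1, w2_mk_rhof ⟨h, hw.2⟩⟩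
  · have hc : ContinuousOn M.vf (Icc 0 M.Rf₁) :=
      M.vf_contDiff.continuousOn.mono (Icc_subset_Icc_right M.Rf₁_lt.le)
    obtain ⟨ρ, hρ, he⟩ := intermediate_value_Icc' M.Rf₁_pos.le hc
      (show M.Wc + M.vf M.Rf₁ - w ∈ Icc (M.vf M.Rf₁) (M.vf 0) by
        have := hw.1
        simp only [Wmin, Vmax] at this
        constructor <;> linarith)
    have hmem := M.mk_mem_Omegaf (Icc_subset_Icc_right M.Rf₁_lt.le hρ)
    refine ⟨_, hmem, ?_⟩
    -- At the density `Rf₁` the branch for `Omegaf₂` applies; there `w = Wc`.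
    rcases hρ.2.lt_or_eq with hlt | rfl
    · rw [w2_of_mem_Omegaf₁ ⟨hmem, hlt⟩, he]
      ring
    · rw [w2_of_mem_Omegaf₂ ⟨hmem, le_rfl⟩]
      simp only [Wc] at he ⊢
      linarith

theorem Wmin_le_w2 {u : State} (hu : u ∈ M.Omegaf) : M.Wmin ≤ M.w2 u := by
  have h0 := M.mk_mem_Omegaf (left_mem_Icc.2 M.Rf₂_pos.le)
  have := w2_mono_of_mem_Omegaf h0 hu hu.1.1
  rwa [w2_of_mem_Omegaf₁ ⟨h0, M.Rf₁_pos⟩] at this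

theorem Wmin_le_Wc : M.Wmin ≤ M.Wc := by
  have := M.antitoneOn_vf (left_mem_Icc.2 M.Rf₂_pos.le) M.Rf₁_mem M.Rf₁_pos.le
  simp only [Wmin, Vmax]
  linarith

theorem w2_mem_Icc_of_mem_Omegac {u : State} (hu : u ∈ M.Omegac) :
    M.w2 u ∈ Icc M.Wc M.Wmax := by
  rw [w2_of_mem_Omegac hu]
  exact hu.2.2

theorem congState_spec {v w : ℝ} (hv : v ∈ Icc 0 M.Vc) (hw : w ∈ Icc M.Wc M.Wmax) :
    M.congState v w ∈ M.Omegac ∧ v + M.p (M.congState v w).1 = w := by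
  have hc : ContinuousOn M.p (Icc M.Rf₁ M.Rmax) :=
    M.p_contDiff.continuousOn.mono Icc_subset_Ici_self
  have h := intermediate_value_Icc M.Rmax_ge hc
    -- The lower bound uses `v ≤ Vc < vf Rf₁`, the upper one `0 ≤ v` and `p Rmax = Wmax`.
    (show w - v ∈ Icc (M.p M.Rf₁) (M.p M.Rmax) by
      have h1 := M.Vc_lt_vf M.Rf₁_mem
      have h2 := hw.1
      have h3 := hw.2
      rw [M.p_Rmax]
      simp only [Wc, Wmax, Vf] at h2 h3
      constructor <;> linarith [hv.1, hv.2])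
  obtain ⟨hmem, he⟩ := Function.invFunOn_pos h
  have he' : v + M.p (M.congState v w).1 = w := by
    simp only [congState, pinv]
    linarith
  exact ⟨⟨hmem, hv, by rw [show (M.congState v w).2 = v from rfl, he']; exact hw⟩, he'⟩

theorem w2_congState {v w : ℝ} (hv : v ∈ Icc 0 M.Vc) (hw : w ∈ Icc M.Wc M.Wmax) :
    M.w2 (M.congState v w) = w := by
  rw [w2_of_mem_Omegac (congState_spec hv hw).1]
  exact (congState_spec hv hw).2

theorem congState_eq {u : State} (hu : u ∈ M.Omegac) : M.congState u.2 (M.w2 u) = u := by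
  have h := congState_spec hu.2.1 (w2_mem_Icc_of_mem_Omegac hu)
  rw [w2_of_mem_Omegac hu] at h ⊢
  refine Prod.ext (M.strictMonoOn_p.injOn h.1.1.1 hu.1.1 ?_) rfl
  linarith [h.2]

/-- States of density at least `R_f'` with second Riemann invariant `w`. -/
def levelCurve (M : Model) (w : ℝ) : Set State := {u | M.Rf₁ ≤ u.1 ∧ u.2 + M.p u.1 = w}

theorem mem_levelCurve_of_mem_Omegac {u : State} (hu : u ∈ M.Omegac) :
    u ∈ M.levelCurve (M.w2 u) := ⟨hu.1.1, (w2_of_mem_Omegac hu).symm⟩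

theorem mem_levelCurve_of_mem_Omegaf₂ {u : State} (hu : u ∈ M.Omegaf₂) :
    u ∈ M.levelCurve (M.w2 u) := ⟨hu.2, (w2_of_mem_Omegaf₂ hu).symm⟩

theorem density_lt_of_mem_levelCurve {a b : State} {w : ℝ} (ha : a ∈ M.levelCurve w)
    (hb : b ∈ M.levelCurve w) (h : a.2 < b.2) : b.1 < a.1 := by
  refine (M.strictMonoOn_p.lt_iff_lt hb.1 ha.1).1 ?_
  linarith [ha.2, hb.2]

/-! ### Comparison of the speeds -/

theorem sigma_lt_sigma_of_mem_levelCurve {a b c : State} {w : ℝ} (ha : a ∈ M.levelCurve w)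
    (hb : b ∈ M.levelCurve w) (hc : c ∈ M.levelCurve w) (hab : b.1 < a.1) (hbc : c.1 < b.1) :
    sigma a b < sigma b c := by
  have h := M.strictConvexOn_mul_p.slope_strict_mono_adjacent hc.1 ha.1 hbc hab
  -- On the curve the flux is `ρ * w - ρ * p ρ`, so a speed is `w` minus a chord slope of the
  -- strictly convex map `ρ * p ρ`.
  have h1 : ∀ {u v : State}, u ∈ M.levelCurve w → v ∈ M.levelCurve w → v.1 < u.1 →
      sigma u v = w - (u.1 * M.p u.1 - v.1 * M.p v.1) / (u.1 - v.1) := by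
    intro u v hu hv huv
    rw [sigma, ← neg_div_neg_eq, eq_sub_iff_add_eq, neg_sub, neg_sub, ← add_div,
      div_eq_iff (by linarith), show u.2 = w - M.p u.1 by linarith [hu.2],
      show v.2 = w - M.p v.1 by linarith [hv.2]]
    ring
  rw [h1 ha hb hab, h1 hb hc hbc]
  linarith

theorem sigma_le_sigma_of_mem_Omegaf {a b c : State} (ha : a ∈ M.Omegaf)
    (hb : b ∈ M.Omegaf) (hc : c ∈ M.Omegaf) (hab : b.1 < a.1) (hbc : c.1 < b.1) :
    sigma a b ≤ sigma b c := by
  have h := M.concaveOn_free_flux.slope_anti_adjacent hc.1 ha.1 hbc hab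
  rw [sigma, sigma, ha.2.2, hb.2.2, hc.2.2, ← neg_div_neg_eq, neg_sub, neg_sub,
    ← neg_div_neg_eq (c.1 * _ - _), neg_sub, neg_sub]
  exact h

theorem sigma_pos_of_mem_Omegaf {a b : State} (ha : a ∈ M.Omegaf) (hb : b ∈ M.Omegaf)
    (hab : a.1 ≠ b.1) : 0 < sigma a b := by
  rw [sigma, ha.2.2, hb.2.2]
  rcases hab.lt_or_gt with h | h
  · exact div_pos (sub_pos.2 (M.strictMonoOn_free_flux ha.1 hb.1 h)) (sub_pos.2 h)
  · exact div_pos_of_neg_of_neg (sub_neg.2 (M.strictMonoOn_free_flux hb.1 ha.1 h)) (sub_neg.2 h)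

/-- Phase transitions from the congested to the free phase move backwards. -/
theorem sigma_neg_of_mem_levelCurve {a b : State} {w : ℝ} (ha : a ∈ M.levelCurve w)
    (hb : b ∈ M.levelCurve w) (hbf : b ∈ M.Omegaf) (hab : b.1 < a.1) : sigma a b < 0 := by
  have hd : HasDerivWithinAt (fun ρ => ρ * M.p ρ)
      (1 * M.p b.1 + b.1 * derivWithin M.p (Ici M.Rf₁) b.1) (Ici M.Rf₁) b.1 :=
    (hasDerivWithinAt_id b.1 _).mul
      (M.p_contDiff.differentiableOn (by norm_num) b.1 hb.1).hasDerivWithinAt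
  -- The chord slope of `ρ * p ρ` is at least its derivative at the free state, so the speed is at
  -- most `v - ρ * p'` there, which is negative by the capacity drop.
  have h := M.strictConvexOn_mul_p.convexOn.le_slope_of_hasDerivWithinAt hb.1 ha.1 hab hd
  have hdrop := M.capacity_drop b.1 ⟨hb.1, hbf.1.2⟩
  rw [slope_def_field, le_div_iff₀ (by linarith)] at h
  rw [← hbf.2.2] at hdrop
  refine div_neg_of_pos_of_neg ?_ (by linarith)
  have h1 : a.2 = w - M.p a.1 := by linarith [ha.2]
  have h2 : b.2 = w - M.p b.1 := by linarith [hb.2]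
  rw [h1, h2]
  rw [h2] at hdrop
  nlinarith [mul_pos (sub_pos.2 hdrop) (sub_pos.2 hab)]

/-- Here and in the next lemma, `sigma a b = b.2 + a.1 * (b.2 - a.2) / (b.1 - a.1)`, and the second
summand is negative. It keeps fronts behind a contact, which moves with speed `b.2`. -/
theorem sigma_lt_right_of_lt {a b : State} (ha : 0 < a.1) (hab : a.1 < b.1) (hv : b.2 < a.2) :
    sigma a b < b.2 := by
  rw [sigma, div_lt_iff₀ (by linarith)]
  nlinarith [mul_pos ha (sub_pos.2 hv)]

theorem sigma_lt_right_of_gt {a b : State} (ha : 0 < a.1) (hab : b.1 < a.1) (hv : a.2 < b.2) :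
    sigma a b < b.2 := by
  rw [sigma, ← neg_div_neg_eq, div_lt_iff₀ (by linarith)]
  nlinarith [mul_pos ha (sub_pos.2 hv)]

theorem sigma_contact {a b : State} (hv : a.2 = b.2) (hab : a ≠ b) : sigma a b = b.2 := by
  have : b.1 - a.1 ≠ 0 := fun h => hab (Prod.ext (by linarith) hv)
  rw [sigma, hv, div_eq_iff this]
  ring

end Model

end TwoPhase

namespace TwoPhase

/-! ### Speeds of the fronts of a fan -/

/-- The states following `ul` in a fan, keyed by the speeds of the fronts. -/
noncomputable def speeds : State → List State → List (ℝ × State)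
  | _, [] => []
  | ul, u :: S => (sigma ul u, u) :: speeds u S

theorem speeds_append (ul : State) (A B : List State) :
    speeds ul (A ++ B) = speeds ul A ++ speeds (lastState ul (speeds ul A)) B := by
  induction A generalizing ul with
  | nil => rfl
  | cons a A ih => simp [speeds, lastState, ih]

theorem speeds_map_snd (ul : State) (S : List State) : (speeds ul S).map Prod.snd = S := by
  induction S generalizing ul with
  | nil => rfl
  | cons a A ih => simp [speeds, ih]

theorem exists_of_mem_speeds {r : State → State → Prop} {ul : State} {S : List State}
    (hr : (ul :: S).IsChain r) {e : ℝ × State} (he : e ∈ speeds ul S) :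
    ∃ a ∈ ul :: S, ∃ b ∈ S, r a b ∧ e.1 = sigma a b := by
  induction S generalizing ul with
  | nil => simp [speeds] at he
  | cons u S ih =>
    obtain ⟨hu, hr⟩ := List.isChain_cons_cons.1 hr
    rcases List.mem_cons.1 he with rfl | he
    · exact ⟨ul, by simp, u, by simp, hu, rfl⟩
    · obtain ⟨a, ha, b, hb, h⟩ := ih hr he
      exact ⟨a, by simp [List.mem_cons.1 ha], b, by simp [hb], h⟩

theorem speeds_isChain {r : ℝ → ℝ → Prop} {q : State → State → Prop} {X : Set State}
    (hX : ∀ a ∈ X, ∀ b ∈ X, ∀ c ∈ X, q a b → q b c → r (sigma a b) (sigma b c))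
    {ul : State} {S : List State} (hS : ∀ u ∈ ul :: S, u ∈ X) (hq : (ul :: S).IsChain q) :
    (speeds ul S).IsChain fun a b => r a.1 b.1 := by
  induction S generalizing ul with
  | nil => simp [speeds]
  | cons u S ih =>
    cases S with
    | nil => simp [speeds]
    | cons u' S =>
      obtain ⟨h1, hq⟩ := List.isChain_cons_cons.1 hq
      obtain ⟨h2, -⟩ := List.isChain_cons_cons.1 hq
      have := ih (fun u hu => hS u (List.mem_cons_of_mem _ hu)) hq
      simp only [speeds] at this ⊢
      exact List.isChain_cons_cons.2
        ⟨hX _ (hS _ (by simp)) _ (hS _ (by simp)) _ (hS _ (by simp)) h1 h2, this⟩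

section Crossings

variable {K : Type*} {F : Set State} {ul : State} {L : List (K × State)}

theorem crossings_eq_nil_of_forall {c : Prop} (h : ∀ u ∈ ul :: L.map Prod.snd, u ∈ F ↔ c) :
    crossings F ul L = [] := by
  induction L generalizing ul with
  | nil => rfl
  | cons a L ih =>
    obtain ⟨y, u⟩ := a
    rw [crossings, if_pos ((h ul (by simp)).trans (h u (by simp)).symm)]
    exact ih fun u' hu' => h u' (List.mem_cons_of_mem _ hu')

/-- Every crossing toggles membership in `F`. Combined with the bound of one crossing per fan, the
end states determine the number of crossings. -/
theorem odd_length_crossings :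
    Odd (crossings F ul L).length ↔ ¬ (ul ∈ F ↔ lastState ul L ∈ F) := by
  induction L generalizing ul with
  | nil => simp [crossings, lastState]
  | cons a L ih =>
    obtain ⟨y, u⟩ := a
    simp only [crossings, lastState]
    split_ifs with h
    · rw [ih, h]
    · rw [List.length_cons, Nat.odd_add_one, ih]
      tauto

end Crossings

namespace Model

variable {M : Model}

/-- The states `S` following `ul` form an admissible solution of the Riemann problem with data
`ul` and `ur`. -/
structure IsFan (M : Model) (ul : State) (S : List State) (ur : State) : Prop where
  mem_Omega : ∀ u ∈ S, u ∈ M.Omega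
  last_eq : lastState ul (speeds ul S) = ur
  pairwise_le : (speeds ul S).Pairwise fun a b => a.1 ≤ b.1
  admissible : JumpsSatisfy M.AdmissibleJump ul (speeds ul S)
  length_le : (crossings M.Omegaf ul (speeds ul S)).length ≤ 1

/-- The strict separation of speeds ensures that no jump of the composite fan mixes fronts of both
parts. -/
theorem IsFan.append {ul um ur : State} {A B : List State} (hA : M.IsFan ul A um)
    (hB : M.IsFan um B ur)
    (hAB : ∀ a ∈ speeds ul A, ∀ b ∈ speeds um B, a.1 < b.1)
    (hc : (crossings M.Omegaf ul (speeds ul A)).length +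
      (crossings M.Omegaf um (speeds um B)).length ≤ 1) :
    M.IsFan ul (A ++ B) ur where
  mem_Omega u hu := (List.mem_append.1 hu).elim (hA.mem_Omega u) (hB.mem_Omega u)
  last_eq := by rw [speeds_append, lastState_append, hA.last_eq, hB.last_eq]
  pairwise_le := by
    rw [speeds_append, hA.last_eq, List.pairwise_append]
    exact ⟨hA.pairwise_le, hB.pairwise_le, fun a ha b hb => (hAB a ha b hb).le⟩
  admissible := by
    rw [speeds_append, hA.last_eq]
    refine hA.admissible.append hAB ?_
    rw [hA.last_eq]
    exact hB.admissible
  length_le := by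
    rw [speeds_append, crossings_append, hA.last_eq, List.length_append]
    exact hc

theorem isFan_nil (u : State) : M.IsFan u [] u where
  mem_Omega := by simp
  last_eq := rfl
  pairwise_le := by simp [speeds]
  admissible := by simp [speeds, JumpsSatisfy]
  length_le := by simp [speeds, crossings]

theorem isFan_singleton {ul ur : State} (hr : ur ∈ M.Omega) (h : M.AdmissibleJump ul ur) :
    M.IsFan ul [ur] ur where
  mem_Omega := by simpa
  last_eq := rfl
  pairwise_le := by simp [speeds]
  admissible := by simpa [speeds, JumpsSatisfy, leftTrace, rightTrace] using h
  length_le := by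
    simp only [speeds, crossings]
    split_ifs <;> simp

/-- For a fan inside one phase admissibility only means that the traces differ. All pairs of states
must be distinct, because fronts of equal speed merge into one jump. -/
theorem isFan_of_pairwise_ne {ul ur : State} {S : List State} {c : Prop}
    (hS : ∀ u ∈ S, u ∈ M.Omega) (hc : ∀ u ∈ ul :: S, u ∈ M.Omegaf ↔ c)
    (hlast : lastState ul (speeds ul S) = ur)
    (hle : (speeds ul S).Pairwise fun a b => a.1 ≤ b.1) (hne : (ul :: S).Pairwise (· ≠ ·)) :
    M.IsFan ul S ur where
  mem_Omega := hS
  last_eq := hlast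
  pairwise_le := hle
  admissible := by
    rw [← speeds_map_snd ul S] at hc hne
    exact (jumpsSatisfy_of_pairwise hle hne).mono fun a ha b hb hab =>
      ⟨hab, fun h => absurd ((hc a ha).trans (hc b hb).symm) h⟩
  length_le := by
    rw [crossings_eq_nil_of_forall (c := c) (by rwa [speeds_map_snd])]
    simp

/-! ### Waves in the free phase -/

theorem epsw_nonneg (n : ℕ) : 0 ≤ M.epsw n :=
  div_nonneg (sub_nonneg.2 Wmin_le_Wc) (by positivity)

theorem epsv_pos (n : ℕ) : 0 < M.epsv n := div_pos M.Vc_pos (by positivity)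

theorem freeWave_of_lt {n : ℕ} {ul ur : State} (hl : ul ∈ M.Omegaf) (hr : ur ∈ M.Omegaf)
    (h : ur.1 < ul.1) :
    ∃ S, M.freeWave n ul ur = S ++ [ur] ∧ (∀ u ∈ S, u ∈ M.Omegaf) ∧
      (ul :: (S ++ [ur])).Pairwise fun a b => b.1 < a.1 := by
  have hne : ul ≠ ur := fun he => h.ne (by rw [he])
  set e := M.epsw n with he
  set N := ⌊(M.w2 ul - M.w2 ur) / e⌋₊ - 1 with hN
  have he0 : 0 ≤ e := epsw_nonneg n
  have key : ∀ i < N, 0 < e ∧ M.freeState (M.w2 ul - (i + 1 : ℕ) * e) ∈ M.Omegaf ∧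
      M.w2 (M.freeState (M.w2 ul - (i + 1 : ℕ) * e)) = M.w2 ul - (i + 1 : ℕ) * e ∧
      M.w2 ur < M.w2 ul - (i + 1 : ℕ) * e := by
    intro i hi
    -- The number of intermediate states is one less than the integer part, so the index leaves a
    -- spare step and the level stays strictly above that of `ur`.
    have h2 : i + 2 ≤ ⌊(M.w2 ul - M.w2 ur) / e⌋₊ := by omega
    -- The step size vanishes when `vf` is constant on `[0, Rf₁]`; the quotient is then `0` and
    -- there are no intermediate states.
    have hpos : 0 < e := by
      refine he0.lt_of_ne fun h0 => ?_
      rw [← h0, div_zero, Nat.floor_zero] at h2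
      omega
    have h3 := (Nat.le_floor_iff' (by omega)).1 h2
    rw [le_div_iff₀ hpos] at h3
    push_cast at h3
    have h4 : M.w2 ur < M.w2 ul - (i + 1 : ℕ) * e := by push_cast; nlinarith
    have h5 : M.w2 ul - (i + 1 : ℕ) * e ∈ Icc M.Wmin M.Wmax :=
      ⟨(Wmin_le_w2 hr).trans h4.le, (sub_le_self _ (by positivity)).trans
        (w2_le_Wmax_of_mem_Omegaf hl)⟩
    exact ⟨hpos, (freeState_spec h5).1, (freeState_spec h5).2, h4⟩
  refine ⟨_, by rw [freeWave, if_neg hne, if_pos h], ?_, ?_⟩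
  · intro u hu
    obtain ⟨i, hi, rfl⟩ := List.mem_map.1 hu
    exact (key i (List.mem_range.1 hi)).2.1
  · refine List.pairwise_cons.2 ⟨?_, List.pairwise_append.2 ⟨?_, by simp, ?_⟩⟩
    · intro u hu
      rcases List.mem_append.1 hu with hu | hu
      · obtain ⟨i, hi, rfl⟩ := List.mem_map.1 hu
        obtain ⟨hpos, h1, h2, -⟩ := key i (List.mem_range.1 hi)
        refine lt_of_w2_lt h1 hl ?_
        rw [h2]
        exact sub_lt_self _ (by positivity)
      · rw [List.mem_singleton.1 hu]
        exact h
    · refine List.pairwise_map.2 (List.pairwise_lt_range.imp_of_mem fun {i j} hi hj hij => ?_)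
      obtain ⟨hpos, h1, h2, -⟩ := key i (List.mem_range.1 hi)
      obtain ⟨-, h1', h2', -⟩ := key j (List.mem_range.1 hj)
      refine lt_of_w2_lt h1' h1 ?_
      rw [h2, h2']
      have : ((i + 1 : ℕ) : ℝ) < (j + 1 : ℕ) := by exact_mod_cast Nat.succ_lt_succ hij
      nlinarith
    · intro u hu v hv
      obtain ⟨i, hi, rfl⟩ := List.mem_map.1 hu
      rw [List.mem_singleton.1 hv]
      obtain ⟨-, h1, h2, h3⟩ := key i (List.mem_range.1 hi)
      exact lt_of_w2_lt hr h1 (by rw [h2]; exact h3)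

theorem freeWave_isFan (n : ℕ) {ul ur : State} (hl : ul ∈ M.Omegaf) (hr : ur ∈ M.Omegaf) :
    M.IsFan ul (M.freeWave n ul ur) ur ∧ (∀ u ∈ M.freeWave n ul ur, u ∈ M.Omegaf) ∧
      ∀ e ∈ speeds ul (M.freeWave n ul ur), 0 < e.1 := by
  by_cases hne : ul = ur
  · subst hne
    rw [freeWave, if_pos rfl]
    exact ⟨isFan_nil _, by simp, by simp [speeds]⟩
  by_cases h : ur.1 < ul.1
  · obtain ⟨S, hS, hf, hp⟩ := freeWave_of_lt (n := n) hl hr h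
    rw [hS]
    have hf' : ∀ u ∈ S ++ [ur], u ∈ M.Omegaf := by
      intro u hu
      rcases List.mem_append.1 hu with hu | hu
      · exact hf u hu
      · rwa [List.mem_singleton.1 hu]
    have hf'' : ∀ u ∈ ul :: (S ++ [ur]), u ∈ M.Omegaf := List.forall_mem_cons.2 ⟨hl, hf'⟩
    have htr : IsTrans (ℝ × State) fun a b => a.1 ≤ b.1 := ⟨fun _ _ _ => le_trans⟩
    refine ⟨isFan_of_pairwise_ne (c := True) (fun u hu => Or.inl (hf' u hu))
      (fun u hu => iff_true_intro (hf'' u hu)) ?_ ?_ (hp.imp fun hab he => ?_), hf', ?_⟩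
    · rw [speeds_append, lastState_append]
      rfl
    · exact List.isChain_iff_pairwise.1 (speeds_isChain (fun a ha b hb c hc =>
        sigma_le_sigma_of_mem_Omegaf ha hb hc) hf'' hp.isChain)
    · rw [he] at hab
      exact lt_irrefl _ hab
    · intro e he
      obtain ⟨a, ha, b, hb, hab, hσ⟩ := exists_of_mem_speeds hp.isChain he
      rw [hσ]
      exact sigma_pos_of_mem_Omegaf (hf'' a ha) (hf' b hb) hab.ne'
  · rw [freeWave, if_neg hne, if_neg h]
    refine ⟨isFan_singleton (Or.inl hr) ⟨hne, fun h => absurd (iff_of_true hl hr) h⟩,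
      by simpa, ?_⟩
    simp only [speeds, List.mem_singleton, forall_eq]
    exact sigma_pos_of_mem_Omegaf hl hr fun he => hne (ext_of_mem_Omegaf hl hr he)

/-! ### Waves of the first family in the congested phase -/

theorem firstWave_of_lt {n : ℕ} {ul : State} {v : ℝ} (hl : ul ∈ M.Omegac)
    (hv : v ∈ Icc 0 M.Vc) (h : ul.2 < v) :
    ∃ S, M.firstWave n ul v = S ++ [M.congState v (M.w2 ul)] ∧
      (∀ u ∈ S, u ∈ M.Omegac ∧ M.w2 u = M.w2 ul) ∧
      (ul :: (S ++ [M.congState v (M.w2 ul)])).Pairwise fun a b => a.2 < b.2 := by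
  set e := M.epsv n with he
  set N := ⌊(v - ul.2) / e⌋₊ - 1 with hN
  have hpos : 0 < e := epsv_pos n
  have hw := w2_mem_Icc_of_mem_Omegac hl
  have key : ∀ i < N, ul.2 + (i + 1 : ℕ) * e < v ∧ ul.2 + (i + 1 : ℕ) * e ∈ Icc 0 M.Vc := by
    intro i hi
    have h2 : i + 2 ≤ ⌊(v - ul.2) / e⌋₊ := by omega
    have h3 := (Nat.le_floor_iff' (by omega)).1 h2
    rw [le_div_iff₀ hpos] at h3
    push_cast at h3
    have h4 : ul.2 + (i + 1 : ℕ) * e < v := by push_cast; nlinarith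
    exact ⟨h4, add_nonneg hl.2.1.1 (by positivity), h4.le.trans hv.2⟩
  refine ⟨_, by rw [firstWave, if_neg h.ne, if_pos h], ?_, ?_⟩
  · intro u hu
    obtain ⟨i, hi, rfl⟩ := List.mem_map.1 hu
    have := (key i (List.mem_range.1 hi)).2
    exact ⟨(congState_spec this hw).1, w2_congState this hw⟩
  · refine List.pairwise_cons.2 ⟨?_, List.pairwise_append.2 ⟨?_, by simp, ?_⟩⟩
    · intro u hu
      rcases List.mem_append.1 hu with hu | hu
      · obtain ⟨i, hi, rfl⟩ := List.mem_map.1 hu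
        exact lt_add_of_pos_right _ (by positivity)
      · rw [List.mem_singleton.1 hu]
        exact h
    · refine List.pairwise_map.2 (List.pairwise_lt_range.imp fun {i j} hij => ?_)
      have : ((i + 1 : ℕ) : ℝ) < (j + 1 : ℕ) := by exact_mod_cast Nat.succ_lt_succ hij
      simp only [congState]
      nlinarith
    · intro u hu u' hu'
      obtain ⟨i, hi, rfl⟩ := List.mem_map.1 hu
      rw [List.mem_singleton.1 hu']
      exact (key i (List.mem_range.1 hi)).1

theorem pos_of_mem_Omegac {u : State} (hu : u ∈ M.Omegac) : 0 < u.1 := M.Rf₁_pos.trans_le hu.1.1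

/-- The bound on the speeds places the wave behind a contact of speed `v`; the increasing velocities
allow it to be continued along the same level curve into the free phase. -/
theorem firstWave_isFan (n : ℕ) {ul : State} {v : ℝ} (hl : ul ∈ M.Omegac)
    (hv : v ∈ Icc 0 M.Vc) :
    M.IsFan ul (M.firstWave n ul v) (M.congState v (M.w2 ul)) ∧
      (∀ u ∈ M.firstWave n ul v, u ∈ M.Omegac ∧ M.w2 u = M.w2 ul) ∧
      (∀ e ∈ speeds ul (M.firstWave n ul v), e.1 < v) ∧
      (ul.2 ≤ v → (ul :: M.firstWave n ul v).Pairwise fun a b => a.2 < b.2) := by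
  have hw := w2_mem_Icc_of_mem_Omegac hl
  have hm := congState_spec hv hw
  have hwm := w2_congState hv hw
  rcases lt_trichotomy ul.2 v with h | h | h
  · obtain ⟨S, hS, hc, hp⟩ := firstWave_of_lt (n := n) hl hv h
    rw [hS]
    set um := M.congState v (M.w2 ul) with hum
    have hc' : ∀ u ∈ S ++ [um], u ∈ M.Omegac ∧ M.w2 u = M.w2 ul := by
      intro u hu
      rcases List.mem_append.1 hu with hu | hu
      · exact hc u hu
      · rw [List.mem_singleton.1 hu]
        exact ⟨hm.1, hwm⟩
    have hc'' : ∀ u ∈ ul :: (S ++ [um]), u ∈ M.Omegac ∧ M.w2 u = M.w2 ul :=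
      List.forall_mem_cons.2 ⟨⟨hl, rfl⟩, hc'⟩
    have hcurve : ∀ u ∈ ul :: (S ++ [um]), u ∈ M.levelCurve (M.w2 ul) := fun u hu =>
      (hc'' u hu).2 ▸ mem_levelCurve_of_mem_Omegac (hc'' u hu).1
    have htr : IsTrans (ℝ × State) fun a b => a.1 < b.1 := ⟨fun _ _ _ => lt_trans⟩
    refine ⟨isFan_of_pairwise_ne (c := False) (fun u hu => Or.inr (hc' u hu).1)
      (fun u hu => iff_false_intro (M.notMem_Omegaf_of_mem_Omegac (hc'' u hu).1)) ?_ ?_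
      (hp.imp fun hab he => ?_), hc', ?_, fun _ => hp⟩
    · rw [speeds_append, lastState_append]
      rfl
    · refine (List.isChain_iff_pairwise.1 (speeds_isChain (r := fun a b => a < b)
        (fun a ha b hb c hc hab hbc => ?_) hcurve hp.isChain)).imp fun h => h.le
      exact sigma_lt_sigma_of_mem_levelCurve ha hb hc (density_lt_of_mem_levelCurve ha hb hab)
        (density_lt_of_mem_levelCurve hb hc hbc)
    · rw [he] at hab
      exact lt_irrefl _ hab
    · intro e he
      obtain ⟨a, ha, b, hb, hab, hσ⟩ := exists_of_mem_speeds hp.isChain he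
      rw [hσ]
      have hbv : b.2 ≤ v := by
        rcases List.mem_append.1 hb with hb' | hb'
        · have := (List.pairwise_append.1 (List.pairwise_cons.1 hp).2).2.2 b hb' um (by simp)
          exact this.le
        · rw [List.mem_singleton.1 hb']
          exact le_rfl
      exact (sigma_lt_right_of_gt (pos_of_mem_Omegac (hc'' a ha).1)
        (density_lt_of_mem_levelCurve (hcurve a ha) (hcurve b (List.mem_cons_of_mem _ hb)) hab)
        hab).trans_le hbv
  · subst h
    rw [firstWave, if_pos rfl, congState_eq hl]
    exact ⟨isFan_nil _, by simp, by simp [speeds], by simp⟩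
  · rw [firstWave, if_neg h.ne', if_neg h.not_gt]
    refine ⟨isFan_singleton (Or.inr hm.1) ⟨fun he => ?_, fun hF => absurd ?_ hF⟩, ?_, ?_,
      fun h' => absurd h' (not_le.2 h)⟩
    · rw [he] at h
      exact lt_irrefl _ h
    · exact iff_of_false (M.notMem_Omegaf_of_mem_Omegac hl) (M.notMem_Omegaf_of_mem_Omegac hm.1)
    · simpa using ⟨hm.1, hwm⟩
    · simp only [speeds, List.mem_singleton, forall_eq]
      have hcm := mem_levelCurve_of_mem_Omegac hm.1
      rw [hwm] at hcm
      exact sigma_lt_right_of_lt (pos_of_mem_Omegac hl)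
        (density_lt_of_mem_levelCurve hcm (mem_levelCurve_of_mem_Omegac hl) h) h

theorem contact_isFan {um ur : State} (hm : um ∈ M.Omegac) (hr : ur ∈ M.Omegac) :
    M.IsFan um (contact um ur) ur := by
  rw [contact]
  split_ifs with h
  · rw [h]
    exact isFan_nil _
  · exact isFan_singleton (Or.inr hr) ⟨h, fun hF => absurd
      (iff_of_false (M.notMem_Omegaf_of_mem_Omegac hm) (M.notMem_Omegaf_of_mem_Omegac hr)) hF⟩

theorem speeds_contact {um ur : State} (hv : um.2 = ur.2) {e : ℝ × State}
    (he : e ∈ speeds um (contact um ur)) : e.1 = ur.2 := by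
  rw [contact] at he
  split_ifs at he with h
  · simp [speeds] at he
  · rw [List.mem_singleton.1 he]
    exact sigma_contact hv h

theorem mem_contact {um ur u : State} (hu : u ∈ contact um ur) : u = ur := by
  rw [contact] at hu
  split_ifs at hu
  · simp at hu
  · exact List.mem_singleton.1 hu

theorem crossings_speeds_eq_nil_of_Omegac {ul : State} {S : List State}
    (h : ∀ u ∈ ul :: S, u ∈ M.Omegac) : crossings M.Omegaf ul (speeds ul S) = [] :=
  crossings_eq_nil_of_forall (c := False) fun u hu =>
    iff_false_intro (M.notMem_Omegaf_of_mem_Omegac (h u (by rwa [speeds_map_snd] at hu)))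

theorem crossings_speeds_eq_nil_of_Omegaf {ul : State} {S : List State}
    (h : ∀ u ∈ ul :: S, u ∈ M.Omegaf) : crossings M.Omegaf ul (speeds ul S) = [] :=
  crossings_eq_nil_of_forall (c := True) fun u hu =>
    iff_true_intro (h u (by rwa [speeds_map_snd] at hu))

/-! ### The Riemann solver -/

theorem congested_isFan (n : ℕ) {ul ur : State} (hl : ul ∈ M.Omegac) (hr : ur ∈ M.Omegac) :
    M.IsFan ul (M.firstWave n ul ur.2 ++ contact (M.congState ur.2 (M.w2 ul)) ur) ur := by
  obtain ⟨h1, h2, h3, -⟩ := firstWave_isFan n hl hr.2.1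
  have hm := (congState_spec hr.2.1 (w2_mem_Icc_of_mem_Omegac hl)).1
  refine h1.append (contact_isFan hm hr) (fun a ha b hb => ?_) ?_
  · rw [speeds_contact (um := M.congState ur.2 (M.w2 ul)) (ur := ur) rfl hb]
    exact h3 a ha
  · rw [crossings_speeds_eq_nil_of_Omegac, crossings_speeds_eq_nil_of_Omegac]
    · simp
    · exact List.forall_mem_cons.2 ⟨hm, fun u hu => mem_contact hu ▸ hr⟩
    · exact List.forall_mem_cons.2 ⟨hl, fun u hu => (h2 u hu).1⟩

/-- The maximum selects the admissible level: `Wc` from `Omegaf₁`, as `G1` allows, and the level of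
`ul` from `Omegaf₂`, as in `G2`. If the density of `ul` is positive, the jump is strictly slower
than the contact. -/
theorem freeToCongested_isFan {ul ur : State} (hl : ul ∈ M.Omegaf) (hr : ur ∈ M.Omegac) :
    M.IsFan ul (M.congState ur.2 (max M.Wc (M.w2 ul)) ::
      contact (M.congState ur.2 (max M.Wc (M.w2 ul))) ur) ur := by
  have hw : max M.Wc (M.w2 ul) ∈ Icc M.Wc M.Wmax :=
    ⟨le_max_left _ _, max_le Wc_le_Wmax (w2_le_Wmax_of_mem_Omegaf hl)⟩
  obtain ⟨hm, -⟩ := congState_spec hr.2.1 hw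
  have hwm := w2_congState hr.2.1 hw
  set um := M.congState ur.2 (max M.Wc (M.w2 ul)) with hum
  have hvm : um.2 = ur.2 := rfl
  have hv : um.2 < ul.2 := (M.le_Vc_of_mem_Omegac hm).trans_lt (Vc_lt_of_mem_Omegaf hl)
  have hne : ∀ u ∈ M.Omegac, ul ≠ u := fun u hu he =>
    M.notMem_Omegaf_of_mem_Omegac hu (he ▸ hl)
  obtain ⟨hρ, hadm⟩ : ul.1 < um.1 ∧ M.AdmissibleJump ul um := by
    by_cases h1 : ul.1 < M.Rf₁
    · refine ⟨h1.trans_le hm.1.1, hne um hm, fun _ => Or.inl (Or.inl ⟨⟨hl, h1⟩, hm, ?_⟩)⟩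
      simp only [hwm, max_eq_left (w2_le_Wc_of_mem_Omegaf₁ ⟨hl, h1⟩), sub_self, zero_mul]
    · have hl2 : ul ∈ M.Omegaf₂ := ⟨hl, not_lt.1 h1⟩
      rw [max_eq_right (Wc_le_w2_of_mem_Omegaf₂ hl2)] at hwm
      exact ⟨density_lt_of_mem_levelCurve (hwm ▸ mem_levelCurve_of_mem_Omegac hm)
        (mem_levelCurve_of_mem_Omegaf₂ hl2) hv, hne um hm,
        fun _ => Or.inl (Or.inr ⟨hl2, hm, hwm.symm⟩)⟩
  have hfan := isFan_singleton (Or.inr hm) hadm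
  have hnil : crossings M.Omegaf um (speeds um (contact um ur)) = [] :=
    crossings_speeds_eq_nil_of_Omegac
      (List.forall_mem_cons.2 ⟨hm, fun u hu => mem_contact hu ▸ hr⟩)
  rcases hl.1.1.lt_or_eq with h0 | h0
  · change M.IsFan ul ([um] ++ contact um ur) ur
    refine hfan.append (contact_isFan hm hr) (fun a ha b hb => ?_) ?_
    · rw [speeds_contact hvm hb, List.mem_singleton.1 ha]
      exact sigma_lt_right_of_lt h0 hρ hv
    · rw [hnil]
      exact hfan.length_le
  -- From the vacuum the jump has the speed of the contact, so the actual discontinuity goes from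
  -- `ul` to `ur`; it lies in `G1` because its left density is zero.
  · by_cases hmr : um = ur
    · rw [contact, if_pos hmr, ← hmr]
      exact hfan
    · rw [contact, if_neg hmr] at hnil ⊢
      have hσ : sigma ul um = ur.2 := by
        rw [sigma, ← h0, zero_mul, sub_zero, sub_zero, ← hvm]
        exact mul_div_cancel_left₀ _ (pos_of_mem_Omegac hm).ne'
      have hσ' : sigma um ur = ur.2 := sigma_contact hvm hmr
      have hjump : M.AdmissibleJump ul ur :=
        ⟨hne ur hr, fun _ => Or.inl (Or.inl ⟨⟨hl, by rw [← h0]; exact M.Rf₁_pos⟩, hr,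
          by simp [← h0]⟩)⟩
      exact
        { mem_Omega := by
            intro u hu
            simp only [List.mem_cons, List.not_mem_nil, or_false] at hu
            rcases hu with rfl | rfl
            · exact Or.inr hm
            · exact Or.inr hr
          last_eq := rfl
          pairwise_le := by simp [speeds, hσ, hσ']
          admissible := by
            simpa [JumpsSatisfy, speeds, hσ, hσ', leftTrace, rightTrace] using hjump
          length_le := by
            have : speeds ul [um, ur] = speeds ul [um] ++ speeds um [ur] := rfl
            rw [this, crossings_append, List.length_append]
            change _ + (crossings M.Omegaf um (speeds um [ur])).length ≤ 1
            rw [hnil]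
            exact hfan.length_le }

theorem congestedToFree_isFan (n : ℕ) {ul ur : State} (hl : ul ∈ M.Omegac)
    (hr : ur ∈ M.Omegaf) :
    M.IsFan ul (M.firstWave n ul M.Vc ++ (M.rhof (M.w2 ul), M.vf (M.rhof (M.w2 ul))) ::
      M.freeWave n (M.rhof (M.w2 ul), M.vf (M.rhof (M.w2 ul))) ur) ur := by
  have hw := w2_mem_Icc_of_mem_Omegac hl
  have hVc : M.Vc ∈ Icc 0 M.Vc := right_mem_Icc.2 M.Vc_pos.le
  obtain ⟨hA, hAc, -, hAp⟩ := firstWave_isFan n hl hVc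
  have hAp := hAp (M.le_Vc_of_mem_Omegac hl)
  have hm := (congState_spec hVc hw).1
  have hwm := w2_congState hVc hw
  have hu2 := mk_rhof_mem hw
  have hwu := w2_mk_rhof hw
  set um := M.congState M.Vc (M.w2 ul) with hum
  set uf : State := (M.rhof (M.w2 ul), M.vf (M.rhof (M.w2 ul))) with huf
  have hcm : um ∈ M.levelCurve (M.w2 ul) := hwm ▸ mem_levelCurve_of_mem_Omegac hm
  have hcf : uf ∈ M.levelCurve (M.w2 ul) := hwu ▸ mem_levelCurve_of_mem_Omegaf₂ hu2
  have hAc' : ∀ u ∈ ul :: M.firstWave n ul M.Vc, u ∈ M.Omegac ∧ M.w2 u = M.w2 ul :=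
    List.forall_mem_cons.2 ⟨⟨hl, rfl⟩, hAc⟩
  have hjump : M.IsFan um [uf] uf :=
    isFan_singleton (Or.inl hu2.1) ⟨fun he => M.notMem_Omegaf_of_mem_Omegac hm (he ▸ hu2.1),
      fun _ => Or.inr ⟨hm, hu2, hwm.trans hwu.symm, rfl⟩⟩
  obtain ⟨hB, hBf, hBpos⟩ := freeWave_isFan n hu2.1 hr
  have hρ : uf.1 < um.1 := density_lt_of_mem_levelCurve hcm hcf (Vc_lt_of_mem_Omegaf hu2.1)
  have hright : M.IsFan um (uf :: M.freeWave n uf ur) ur := by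
    change M.IsFan um ([uf] ++ M.freeWave n uf ur) ur
    refine hjump.append hB (fun a ha b hb => ?_) ?_
    · rw [List.mem_singleton.1 ha]
      exact (sigma_neg_of_mem_levelCurve hcm hcf hu2.1 hρ).trans (hBpos b hb)
    · rw [crossings_speeds_eq_nil_of_Omegaf (List.forall_mem_cons.2 ⟨hu2.1, hBf⟩)]
      exact hjump.length_le
  -- The states of the first wave followed by `uf` have increasing velocities along one level curve,
  -- so strict concavity of the flux orders all these fronts at once.
  have hlt : ∀ a ∈ speeds ul (M.firstWave n ul M.Vc), a.1 < sigma um uf := by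
    have hp : (ul :: (M.firstWave n ul M.Vc ++ [uf])).Pairwise fun a b => a.2 < b.2 := by
      rw [← List.cons_append, List.pairwise_append]
      refine ⟨hAp, by simp, fun a ha b hb => ?_⟩
      rw [List.mem_singleton.1 hb]
      exact (M.le_Vc_of_mem_Omegac (hAc' a ha).1).trans_lt (Vc_lt_of_mem_Omegaf hu2.1)
    have hcurve : ∀ u ∈ ul :: (M.firstWave n ul M.Vc ++ [uf]), u ∈ M.levelCurve (M.w2 ul) := by
      intro u hu
      rw [← List.cons_append] at hu
      rcases List.mem_append.1 hu with hu | hu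
      · exact (hAc' u hu).2 ▸ mem_levelCurve_of_mem_Omegac (hAc' u hu).1
      · rw [List.mem_singleton.1 hu]
        exact hcf
    have htr : IsTrans (ℝ × State) fun a b => a.1 < b.1 := ⟨fun _ _ _ => lt_trans⟩
    have hs := List.isChain_iff_pairwise.1 (speeds_isChain (r := fun a b => a < b)
      (fun a ha b hb c hc hab hbc => sigma_lt_sigma_of_mem_levelCurve ha hb hc
        (density_lt_of_mem_levelCurve ha hb hab) (density_lt_of_mem_levelCurve hb hc hbc))
      hcurve hp.isChain)
    rw [speeds_append, hA.last_eq, List.pairwise_append] at hs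
    exact fun a ha => hs.2.2 a ha (sigma um uf, uf) (by simp [speeds])
  refine hA.append hright (fun a ha b hb => ?_) ?_
  · have hle : sigma um uf ≤ b.1 := by
      rcases List.mem_cons.1 hb with rfl | hb'
      · exact le_rfl
      · exact (List.pairwise_cons.1 hright.pairwise_le).1 b hb'
    exact (hlt a ha).trans_le hle
  · rw [crossings_speeds_eq_nil_of_Omegac fun u hu => (hAc' u hu).1, List.length_nil, zero_add]
    exact hright.length_le

theorem riemann_isFan (n : ℕ) {ul ur : State} (hl : ul ∈ M.Omega) (hr : ur ∈ M.Omega) :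
    M.IsFan ul (M.riemann n ul ur) ur := by
  rw [riemann]
  split_ifs with h1 h2 h2
  · exact (freeWave_isFan n h1 h2).1
  · exact freeToCongested_isFan h1 (hr.resolve_left h2)
  · exact congestedToFree_isFan n (hl.resolve_left h1) h2
  · exact congested_isFan n (hl.resolve_left h1) (hr.resolve_left h2)

end Model

end TwoPhase

namespace TwoPhase

/-! ### Resolution of the jumps -/

theorem keyed_append (ul : State) (A B : List (ℝ × State)) :
    keyed ul (A ++ B) = keyed ul A ++ keyed (lastState ul A) B := by
  induction A generalizing ul with
  | nil => rfl
  | cons a A ih => simp [keyed, lastState, ih]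

theorem keyed_map_mk (ul : State) (y : ℝ) (S : List State) :
    keyed ul (S.map fun a => (y, a)) =
      (speeds ul S).map (Prod.map (fun c => toLex (y, c)) id) := by
  induction S generalizing ul with
  | nil => rfl
  | cons a A ih => simp [keyed, speeds, ih]

theorem lastState_map_mk (ul : State) (y : ℝ) (S : List State) :
    lastState ul (S.map fun a => (y, a)) = lastState ul (speeds ul S) := by
  induction S generalizing ul with
  | nil => rfl
  | cons a A ih => exact ih a

theorem strictMono_toLex_mk (y : ℝ) : StrictMono fun c : ℝ => toLex (y, c) := fun a b h => by
  simpa [Prod.Lex.lt_iff] using h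

namespace Model

variable {M : Model}

theorem exists_of_mem_keyed_resolve (n : ℕ) {ul : State} {J : List (ℝ × State)}
    (hΩ : ∀ u ∈ ul :: J.map Prod.snd, u ∈ M.Omega) {a : (ℝ ×ₗ ℝ) × State}
    (ha : a ∈ keyed ul (M.resolve n ul J)) : ∃ b ∈ J, (ofLex a.1).1 = b.1 := by
  induction J generalizing ul with
  | nil => simp [resolve, keyed] at ha
  | cons b J ih =>
    obtain ⟨y, u⟩ := b
    obtain ⟨hul, hΩ⟩ := List.forall_mem_cons.1 hΩ
    have hfan := riemann_isFan n hul (hΩ u (by simp))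
    rw [resolve, keyed_append, keyed_map_mk, lastState_map_mk, hfan.last_eq] at ha
    rcases List.mem_append.1 ha with ha | ha
    · obtain ⟨c, hc, rfl⟩ := List.mem_map.1 ha
      exact ⟨(y, u), by simp, rfl⟩
    · obtain ⟨c, hc, h⟩ := ih hΩ ha
      exact ⟨c, List.mem_cons_of_mem _ hc, h⟩

/-- Fans from different origins are ordered by the first component of the key. Each has at most one
crossing, with the parity prescribed by its end states, so solving the Riemann problems preserves
the number of crossings. -/
theorem resolve_isResolved (n : ℕ) {ul : State} {J : List (ℝ × State)}
    (hJ : J.Pairwise fun a b => a.1 < b.1) (hΩ : ∀ u ∈ ul :: J.map Prod.snd, u ∈ M.Omega) :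
    M.IsResolved ul (M.resolve n ul J) ∧
      (crossings M.Omegaf ul (keyed ul (M.resolve n ul J))).length =
        (crossings M.Omegaf ul J).length := by
  induction J generalizing ul with
  | nil =>
    exact ⟨⟨by simpa [resolve] using hΩ, by simp [resolve, keyed],
      by simp [resolve, keyed, JumpsSatisfy], by simp [resolve, keyed, crossings]⟩, rfl⟩
  | cons b J ih =>
    obtain ⟨y, u⟩ := b
    obtain ⟨hy, hJ⟩ := List.pairwise_cons.1 hJ
    obtain ⟨hul, hΩ⟩ := List.forall_mem_cons.1 hΩ
    have hΩ : ∀ u' ∈ u :: J.map Prod.snd, u' ∈ M.Omega := hΩ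
    have hfan := riemann_isFan n hul (hΩ u (by simp))
    obtain ⟨hres, hlen⟩ := ih hJ hΩ
    have hkey : keyed ul (M.resolve n ul ((y, u) :: J)) =
        (speeds ul (M.riemann n ul u)).map (Prod.map (fun c => toLex (y, c)) id) ++
          keyed u (M.resolve n u J) := by
      rw [resolve, keyed_append, keyed_map_mk, lastState_map_mk, hfan.last_eq]
    have hlt : ∀ a ∈ (speeds ul (M.riemann n ul u)).map (Prod.map (fun c => toLex (y, c)) id),
        ∀ b ∈ keyed u (M.resolve n u J), a.1 < b.1 := by
      intro a ha b hb
      obtain ⟨c, hc, rfl⟩ := List.mem_map.1 ha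
      obtain ⟨d, hd, h⟩ := exists_of_mem_keyed_resolve n hΩ hb
      rw [Prod.Lex.lt_iff]
      left
      rw [h]
      exact hy d hd
    have hcross : crossings M.Omegaf ul (keyed ul (M.resolve n ul ((y, u) :: J))) =
        (crossings M.Omegaf ul (speeds ul (M.riemann n ul u))).map (fun c => toLex (y, c)) ++
          crossings M.Omegaf u (keyed u (M.resolve n u J)) := by
      rw [hkey, crossings_append, crossings_map, lastState_map, hfan.last_eq]
    refine ⟨⟨?_, ?_, ?_, ?_⟩, ?_⟩
    · intro u' hu'
      rw [resolve, List.map_append, List.map_map] at hu'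
      rcases List.mem_cons.1 hu' with rfl | hu'
      · exact hul
      rcases List.mem_append.1 hu' with hu' | hu'
      · obtain ⟨c, hc, rfl⟩ := List.mem_map.1 hu'
        exact hfan.mem_Omega c hc
      · exact hres.mem_Omega u' (List.mem_cons_of_mem _ hu')
    · rw [hkey, List.pairwise_append, List.pairwise_map]
      exact ⟨hfan.pairwise_le.imp fun h => (strictMono_toLex_mk y).monotone h,
        hres.pairwise_le, fun a ha b hb => (hlt a ha b hb).le⟩
    · rw [hkey]
      refine (hfan.admissible.map (strictMono_toLex_mk y)).append hlt ?_
      rw [lastState_map, hfan.last_eq]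
      exact hres.admissible
    · rw [hcross, List.nodup_append]
      refine ⟨?_, hres.nodup, ?_⟩
      · refine List.Nodup.map (strictMono_toLex_mk y).injective ?_
        have := hfan.length_le
        rcases hc : crossings M.Omegaf ul (speeds ul (M.riemann n ul u)) with _ | ⟨c, _ | ⟨d, l⟩⟩
        · simp
        · simp
        · rw [hc] at this
          simp at this
      · intro a ha b hb hab
        rw [← crossings_map] at ha
        obtain ⟨c, hc, rfl⟩ := exists_mem_of_mem_crossings ha
        obtain ⟨d, hd, rfl⟩ := exists_mem_of_mem_crossings hb
        exact (hlt c hc d hd).ne hab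
    · have h1 := hfan.length_le
      have h2 := odd_length_crossings (F := M.Omegaf) (ul := ul)
        (L := speeds ul (M.riemann n ul u))
      rw [hfan.last_eq] at h2
      rw [hcross, List.length_append, List.length_map, hlen, crossings]
      split_ifs with h
      · have : ¬ Odd (crossings M.Omegaf ul (speeds ul (M.riemann n ul u))).length :=
          fun ho => h2.1 ho h
        rw [Nat.not_odd_iff] at this
        omega
      · have := Nat.odd_iff.1 (h2.2 h)
        rw [List.length_cons]
        omega

/-! ### The algorithm -/

section Tracking

variable (M) (n : ℕ) (ul : State) (J : List (ℝ × State))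

/-- The fronts issuing from the `k`-th interaction time. -/
noncomputable def frontsAt (k : ℕ) : List (ℝ × State) := (M.tracking n ul J k).2

/-- The time between the `k`-th interaction time and the next one. -/
noncomputable def waiting (k : ℕ) : WithTop ℝ := (meetTimes ul (M.frontsAt n ul J k)).minimum

/-- The number of fronts issuing from the `k`-th interaction time that change the phase. -/
noncomputable def phaseChanges (k : ℕ) : ℕ :=
  (crossings M.Omegaf ul (keyed ul (M.frontsAt n ul J k))).length

theorem time_zero : M.time n ul J 0 = 0 := rfl

theorem time_succ (k : ℕ) : M.time n ul J (k + 1) = M.time n ul J k + M.waiting n ul J k := rfl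

theorem frontsAt_succ (k : ℕ) : M.frontsAt n ul J (k + 1) = M.resolve n ul
    (collapse (evolve ul (M.frontsAt n ul J k) ((M.waiting n ul J k).untopD 0))) := rfl

variable {M n ul J} (hJ : J.Pairwise fun a b => a.1 < b.1)
  (hΩ : ∀ u ∈ ul :: J.map Prod.snd, u ∈ M.Omega)

theorem IsResolved.collapse_spec {L : List (ℝ × State)} (h : M.IsResolved ul L) {s : ℝ}
    (hs0 : 0 ≤ s) (hs : (s : WithTop ℝ) ≤ (meetTimes ul L).minimum) :
    (collapse (evolve ul L s)).Pairwise (fun a b => a.1 < b.1) ∧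
      ∀ u ∈ ul :: (collapse (evolve ul L s)).map Prod.snd, u ∈ M.Omega := by
  refine ⟨collapse_pairwise (evolve_pairwise h.pairwise_le hs0 hs), fun u hu => ?_⟩
  rcases List.mem_cons.1 hu with rfl | hu
  · exact h.mem_Omega _ (by simp)
  · exact h.evolve_mem_Omega s u
      (List.mem_cons_of_mem _ (((collapse_sublist _).map Prod.snd).subset hu))

/-- When no fronts meet any more, the algorithm formally evolves by the default time `0`; the
invariant has to cover this case too. -/
theorem IsResolved.untopD_spec {L : List (ℝ × State)} (h : M.IsResolved ul L) :
    0 ≤ (meetTimes ul L).minimum.untopD 0 ∧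
      (((meetTimes ul L).minimum.untopD 0 : ℝ) : WithTop ℝ) ≤ (meetTimes ul L).minimum := by
  have := minimum_meetTimes_pos h.pairwise_le
  cases hm : (meetTimes ul L).minimum with
  | top => simp
  | coe m =>
    rw [hm] at this
    exact ⟨(WithTop.coe_lt_coe.1 this).le, le_rfl⟩

include hJ hΩ

theorem frontsAt_isResolved (k : ℕ) : M.IsResolved ul (M.frontsAt n ul J k) := by
  induction k with
  | zero => exact (resolve_isResolved n hJ hΩ).1
  | succ k ih =>
    obtain ⟨h1, h2⟩ := ih.collapse_spec ih.untopD_spec.1 ih.untopD_spec.2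
    exact (resolve_isResolved n h1 h2).1

theorem waiting_pos (k : ℕ) : 0 < M.waiting n ul J k :=
  minimum_meetTimes_pos (frontsAt_isResolved hJ hΩ k).pairwise_le

theorem phaseChanges_zero : M.numPT (profile ul J) = M.phaseChanges n ul J 0 := by
  rw [numPT_profile_of_pairwise_lt hΩ hJ]
  exact (resolve_isResolved n hJ hΩ).2.symm

/-- Collapsing does not change the profile and makes the positions distinct, so phase transitions
are crossings of the collapsed list, whose number `resolve` preserves. -/
theorem phaseChanges_succ {k : ℕ} {m : ℝ} (hm : M.waiting n ul J k = m) :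
    M.numPT (profile ul (evolve ul (M.frontsAt n ul J k) m)) = M.phaseChanges n ul J (k + 1) := by
  have h := frontsAt_isResolved (n := n) hJ hΩ k
  have h0 : 0 ≤ m := by
    have := waiting_pos (n := n) hJ hΩ k
    rw [hm] at this
    exact (WithTop.coe_lt_coe.1 this).le
  obtain ⟨h1, h2⟩ := h.collapse_spec h0 hm.ge
  rw [phaseChanges, frontsAt_succ, hm, WithTop.untopD_coe, (resolve_isResolved n h1 h2).2,
    ← numPT_profile_of_pairwise_lt h2 h1]
  congr 1
  funext x
  exact (profile_collapse _ _ _).symm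

theorem time_lt_time_succ {k : ℕ} {a : ℝ} (ha : M.time n ul J k = a) :
    M.time n ul J k < M.time n ul J (k + 1) := by
  have := waiting_pos (n := n) hJ hΩ k
  rw [time_succ, ha]
  cases h : M.waiting n ul J k with
  | top => exact WithTop.coe_lt_top a
  | coe m =>
    rw [h] at this
    have := WithTop.coe_lt_coe.1 this
    exact WithTop.coe_lt_coe.2 (by linarith)

theorem monotone_time : Monotone (M.time n ul J) := by
  refine monotone_nat_of_le_succ fun k => ?_
  cases h : M.time n ul J k with
  | top => simp [time_succ, h]
  | coe a =>
    rw [← h]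
    exact (time_lt_time_succ hJ hΩ h).le

theorem time_nonneg (k : ℕ) : 0 ≤ M.time n ul J k := monotone_time hJ hΩ (Nat.zero_le k)

theorem approx_of_nonpos {t : ℝ} (ht : t ≤ 0) : M.approx n ul J t = profile ul J := by
  funext x
  rw [approx, dif_neg]
  rintro ⟨k, hk, -⟩
  exact ((time_nonneg hJ hΩ k).trans_lt hk).not_ge (WithTop.coe_le_coe.2 ht)

theorem approx_eq {k : ℕ} {a t : ℝ} (ha : M.time n ul J k = a) (hat : a < t)
    (ht : (t : WithTop ℝ) ≤ M.time n ul J (k + 1)) :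
    M.approx n ul J t = profile ul (evolve ul (M.frontsAt n ul J k) (t - a)) := by
  funext x
  have h : ∃ k, M.time n ul J k < t ∧ (t : WithTop ℝ) ≤ M.time n ul J (k + 1) :=
    ⟨k, by rw [ha]; exact WithTop.coe_lt_coe.2 hat, ht⟩
  -- The intervals that are open on the left and closed on the right between successive times are
  -- disjoint, so the chosen index is the given one.
  have hk : h.choose = k := by
    obtain ⟨h1, h2⟩ := h.choose_spec
    rcases lt_trichotomy h.choose k with hlt | heq | hlt
    · have := h2.trans (monotone_time hJ hΩ (Nat.succ_le_of_lt hlt))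
      rw [ha] at this
      exact absurd (WithTop.coe_le_coe.1 this) (not_le.2 hat)
    · exact heq
    · exact absurd h1 (not_lt.2 (ht.trans (monotone_time hJ hΩ (Nat.succ_le_of_lt hlt))))
  rw [approx, dif_pos h, hk, ha]
  rfl

omit hJ hΩ in
theorem le_time_succ_iff {k : ℕ} {a t : ℝ} (ha : M.time n ul J k = a) :
    (t : WithTop ℝ) ≤ M.time n ul J (k + 1) ↔ ((t - a : ℝ) : WithTop ℝ) ≤ M.waiting n ul J k := by
  rw [time_succ, ha]
  cases M.waiting n ul J k with
  | top => simp
  | coe m =>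
    rw [← WithTop.coe_add, WithTop.coe_le_coe, WithTop.coe_le_coe, sub_le_iff_le_add, add_comm]

omit hJ hΩ in
theorem lt_time_succ_iff {k : ℕ} {a t : ℝ} (ha : M.time n ul J k = a) :
    (t : WithTop ℝ) < M.time n ul J (k + 1) ↔ ((t - a : ℝ) : WithTop ℝ) < M.waiting n ul J k := by
  rw [time_succ, ha]
  cases M.waiting n ul J k with
  | top =>
    rw [add_top]
    exact iff_of_true (WithTop.coe_lt_top _) (WithTop.coe_lt_top _)
  | coe m =>
    rw [← WithTop.coe_add, WithTop.coe_lt_coe, WithTop.coe_lt_coe, sub_lt_iff_lt_add, add_comm]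

omit hJ hΩ in
theorem exists_eq_coe_of_le {w : WithTop ℝ} {t : ℝ} (h : w ≤ t) : ∃ a : ℝ, w = a ∧ a ≤ t := by
  cases w with
  | top => simp at h
  | coe a => exact ⟨a, rfl, WithTop.coe_le_coe.1 h⟩

omit hJ hΩ in
theorem exists_window {t : ℝ} (ht0 : 0 < t) (ht : M.Reached n ul J t) :
    ∃ k, ∃ a : ℝ, M.time n ul J k = a ∧ a < t ∧ (t : WithTop ℝ) ≤ M.time n ul J (k + 1) := by
  classical
  have hspec := Nat.find_spec ht
  obtain ⟨k, hk⟩ : ∃ k, Nat.find ht = k + 1 := by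
    refine Nat.exists_eq_succ_of_ne_zero fun h0 => ?_
    rw [h0, time_zero] at hspec
    exact absurd (WithTop.coe_le_coe.1 hspec) (not_le.2 ht0)
  have hlt := not_le.1 (Nat.find_min ht (m := k) (by omega))
  obtain ⟨a, ha, -⟩ := exists_eq_coe_of_le hlt.le
  rw [ha] at hlt
  exact ⟨k, a, ha, WithTop.coe_lt_coe.1 hlt, hk ▸ hspec⟩

/-- The intervals are closed on the left here, unlike in `exists_window`: the solution is left
continuous, but the number of its phase transitions already has its new value at an interaction
time. -/
theorem exists_index {t : ℝ} (ht0 : 0 ≤ t) (ht : M.Reached n ul J t) :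
    ∃ k, ∃ a : ℝ, M.time n ul J k = a ∧ a ≤ t ∧ (t : WithTop ℝ) < M.time n ul J (k + 1) := by
  rcases ht0.lt_or_eq with ht0 | rfl
  · obtain ⟨k, a, ha, hat, hle⟩ := exists_window ht0 ht
    rcases hle.lt_or_eq with hlt | he
    · exact ⟨k, a, ha, hat.le, hlt⟩
    · exact ⟨k + 1, t, he.symm, le_rfl, he ▸ time_lt_time_succ hJ hΩ he.symm⟩
  · exact ⟨0, 0, rfl, le_rfl, time_lt_time_succ (a := 0) hJ hΩ rfl⟩

theorem numPT_approx {k : ℕ} {a t : ℝ} (ha : M.time n ul J k = a) (hat : a ≤ t)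
    (ht : (t : WithTop ℝ) < M.time n ul J (k + 1)) :
    M.numPT (M.approx n ul J t) = M.phaseChanges n ul J k := by
  rcases hat.lt_or_eq with hlt | rfl
  · rw [approx_eq hJ hΩ ha hlt ht.le]
    exact (frontsAt_isResolved hJ hΩ k).numPT_eq_length (sub_pos.2 hlt) ((lt_time_succ_iff ha).1 ht)
  · cases k with
    | zero =>
      have : a = 0 := (WithTop.coe_eq_coe.1 ha).symm
      rw [approx_of_nonpos hJ hΩ this.le]
      exact phaseChanges_zero hJ hΩ
    | succ k =>
      obtain ⟨b, hb, -⟩ := exists_eq_coe_of_le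
        ((monotone_time hJ hΩ (Nat.le_succ k)).trans ha.le)
      have hba : b < a := by
        have := time_lt_time_succ hJ hΩ hb
        rw [ha, hb] at this
        exact WithTop.coe_lt_coe.1 this
      have hm : M.waiting n ul J k = ((a - b : ℝ) : WithTop ℝ) := by
        refine le_antisymm (not_lt.1 fun h => ?_) ((le_time_succ_iff hb).1 ha.ge)
        exact ((lt_time_succ_iff hb).2 h).ne ha.symm
      rw [approx_eq hJ hΩ hb hba ha.ge]
      exact phaseChanges_succ hJ hΩ hm

end Tracking

end Model

end TwoPhase

namespace TwoPhase

/-! ### Interactions -/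

theorem meetAt_of_positions {P : ℝ → ℝ → Prop} {a t x : ℝ} (hat : a < t) {k k' : ℝ ×ₗ ℝ}
    (hk : position (t - a) k = x) (hk' : position (t - a) k' = x)
    (h : ∀ s ∈ Ioo a t, position (s - a) k < position (s - a) k' ∧
      P s (position (s - a) k) ∧ P s (position (s - a) k')) : MeetAt P t x := by
  have hc : ∀ k : ℝ ×ₗ ℝ, Continuous fun s => position (s - a) k := fun k =>
    (continuous_position k).comp (continuous_id.sub continuous_const)
  refine ⟨t - a, sub_pos.2 hat, fun s => position (s - a) k, fun s => position (s - a) k',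
    (hc k).continuousOn, (hc k').continuousOn, ?_, ?_, fun s hs => h s (by simpa using hs)⟩
  · rw [← hk]
    exact ((hc k).tendsto t).mono_left nhdsWithin_le_nhds
  · rw [← hk']
    exact ((hc k').tendsto t).mono_left nhdsWithin_le_nhds

/-- If the points near `(t, x)` with property `P` lie on finitely many lines, and two distinct
curves of such points meet at `(t, x)`, then so do two of these lines. -/
theorem MeetAt.exists_positions {P : ℝ → ℝ → Prop} {a t x : ℝ} (hat : a < t)
    {A : List (ℝ ×ₗ ℝ)} (h : MeetAt P t x)
    (hA : ∀ s ∈ Ioo a t, ∀ y, P s y → ∃ k ∈ A, position (s - a) k = y) :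
    ∃ k ∈ A, ∃ k' ∈ A, k ≠ k' ∧ position (t - a) k = x ∧ position (t - a) k' = x := by
  obtain ⟨δ, hδ, ξ₁, ξ₂, -, -, h₁, h₂, hP⟩ := h
  by_contra hcon
  push Not at hcon
  have hc : ∀ k : ℝ ×ₗ ℝ, Tendsto (fun s => position (s - a) k) (𝓝[<] t)
      (𝓝 (position (t - a) k)) := fun k =>
    (((continuous_position k).comp (continuous_id.sub continuous_const)).tendsto t).mono_left
      nhdsWithin_le_nhds
  -- A line that misses `(t, x)` is disjoint from the curve close to `t`; finiteness of the family
  -- makes this uniform.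
  have hsep : ∀ ξ : ℝ → ℝ, Tendsto ξ (𝓝[<] t) (𝓝 x) →
      ∀ᶠ s in 𝓝[<] t, ∀ k ∈ A, position (s - a) k = ξ s → position (t - a) k = x := by
    intro ξ hξ
    have : ∀ᶠ s in 𝓝[<] t, ∀ k ∈ {k | k ∈ A}, position (s - a) k = ξ s →
        position (t - a) k = x := by
      refine (eventually_all_finite (List.finite_toSet A)).2 fun k _ => ?_
      by_cases hk : position (t - a) k = x
      · exact Eventually.of_forall fun _ _ => hk
      · filter_upwards [((hc k).prodMk_nhds hξ).eventually
          (isOpen_ne_fun continuous_fst continuous_snd |>.mem_nhds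
            (show (position (t - a) k, x).1 ≠ (position (t - a) k, x).2 from hk))] with s hs he
        exact absurd he hs
    exact this
  have hev : ∀ᶠ s in 𝓝[<] t, s ∈ Ioo (max a (t - δ)) t :=
    Ioo_mem_nhdsLT (max_lt hat (by linarith))
  -- A single late time suffices: there the two curves occupy different points, hence lie on
  -- different lines, both passing through `(t, x)`.
  obtain ⟨s, hs, hs₁, hs₂⟩ := (hev.and ((hsep ξ₁ h₁).and (hsep ξ₂ h₂))).exists
  obtain ⟨hlt, hP₁, hP₂⟩ := hP s ⟨(le_max_right _ _).trans_lt hs.1, hs.2⟩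
  have hsa : s ∈ Ioo a t := ⟨(le_max_left _ _).trans_lt hs.1, hs.2⟩
  obtain ⟨k, hk, he⟩ := hA s hsa _ hP₁
  obtain ⟨k', hk', he'⟩ := hA s hsa _ hP₂
  refine hcon k hk k' hk' (fun hkk => ?_) (hs₁ k hk he) (hs₂ k' hk' he')
  rw [← he, ← he', hkk] at hlt
  exact lt_irrefl _ hlt

namespace Model

section Interactions

variable {M : Model} {n : ℕ} {ul : State} {J : List (ℝ × State)}
  (hJ : J.Pairwise fun a b => a.1 < b.1) (hΩ : ∀ u ∈ ul :: J.map Prod.snd, u ∈ M.Omega)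
include hJ hΩ

theorem frontsInteract_of_position_eq {k : ℕ} {a t x : ℝ} (ha : M.time n ul J k = a)
    (hat : a < t) (ht : (t : WithTop ℝ) ≤ M.time n ul J (k + 1)) {b c : (ℝ ×ₗ ℝ) × State}
    (hb : b ∈ keyed ul (M.frontsAt n ul J k)) (hc : c ∈ keyed ul (M.frontsAt n ul J k))
    (hbc : b.1 < c.1) (hbx : position (t - a) b.1 = x) (hcx : position (t - a) c.1 = x) :
    FrontsInteract (M.approx n ul J) t x := by
  have hres := frontsAt_isResolved (n := n) hJ hΩ k
  refine meetAt_of_positions hat hbx hcx fun s hs => ?_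
  have hst : (s : WithTop ℝ) < M.time n ul J (k + 1) :=
    (WithTop.coe_lt_coe.2 hs.2).trans_le ht
  have hs0 : 0 < s - a := sub_pos.2 hs.1
  have hsw := (lt_time_succ_iff ha).1 hst
  rw [approx_eq hJ hΩ ha hs.1 hst.le]
  exact ⟨position_strictMono hres.pairwise_le hs0 hsw hb hc hbc,
    hres.not_continuousAt_evolve hs0 hsw hb, hres.not_continuousAt_evolve hs0 hsw hc⟩

/-- Before `t` the phase transitions are exactly the points on the lines of the crossings. Curves
that meet force two of these lines to meet, and two lines that meet are themselves such curves. -/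
theorem phaseTransitionsInteract_iff {k : ℕ} {a t : ℝ} (ha : M.time n ul J k = a)
    (hat : a < t) (ht : (t : WithTop ℝ) ≤ M.time n ul J (k + 1)) :
    (∃ x, M.PhaseTransitionsInteract (M.approx n ul J) t x) ↔
      ¬ ((crossings M.Omegaf ul (keyed ul (M.frontsAt n ul J k))).map (position (t - a))).Nodup := by
  have hres := frontsAt_isResolved (n := n) hJ hΩ k
  have hmem : ∀ s ∈ Ioo a t, ∀ y, y ∈ M.phaseTransitions (M.approx n ul J s) ↔
      ∃ κ ∈ crossings M.Omegaf ul (keyed ul (M.frontsAt n ul J k)), position (s - a) κ = y := by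
    intro s hs y
    have hst : (s : WithTop ℝ) < M.time n ul J (k + 1) :=
      (WithTop.coe_lt_coe.2 hs.2).trans_le ht
    rw [approx_eq hJ hΩ ha hs.1 hst.le]
    exact hres.mem_phaseTransitions_evolve (sub_pos.2 hs.1) ((lt_time_succ_iff ha).1 hst) y
  constructor
  · rintro ⟨x, hx⟩ hnd
    obtain ⟨κ, hκ, κ', hκ', hne, h1, h2⟩ :=
      MeetAt.exists_positions hat hx fun s hs y => (hmem s hs y).1
    exact hne (List.inj_on_of_nodup_map hnd hκ hκ' (h1.trans h2.symm))
  · intro hnd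
    obtain ⟨κ, hκ, κ', hκ', hlt, he⟩ : ∃ κ ∈ crossings M.Omegaf ul
        (keyed ul (M.frontsAt n ul J k)), ∃ κ' ∈ crossings M.Omegaf ul
        (keyed ul (M.frontsAt n ul J k)), κ < κ' ∧ position (t - a) κ = position (t - a) κ' := by
      by_contra hcon
      push Not at hcon
      refine hnd (List.Nodup.map_on (fun κ hκ κ' hκ' he => ?_) hres.nodup)
      rcases lt_trichotomy κ κ' with h | h | h
      · exact absurd he (hcon κ hκ κ' hκ' h)
      · exact h
      · exact absurd he.symm (hcon κ' hκ' κ hκ h)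
    refine ⟨_, meetAt_of_positions hat rfl he.symm fun s hs =>
      ⟨?_, (hmem s hs _).2 ⟨κ, hκ, rfl⟩, (hmem s hs _).2 ⟨κ', hκ', rfl⟩⟩⟩
    have hst : (s : WithTop ℝ) < M.time n ul J (k + 1) :=
      (WithTop.coe_lt_coe.2 hs.2).trans_le ht
    obtain ⟨b, hb, rfl⟩ := exists_mem_of_mem_crossings hκ
    obtain ⟨c, hc, rfl⟩ := exists_mem_of_mem_crossings hκ'
    exact position_strictMono hres.pairwise_le (sub_pos.2 hs.1) ((lt_time_succ_iff ha).1 hst)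
      hb hc hlt

/-- Phase transitions interact only at interaction times. -/
theorem eq_time_succ_of_interact {k : ℕ} {a t x : ℝ} (ha : M.time n ul J k = a)
    (hat : a < t) (ht : (t : WithTop ℝ) ≤ M.time n ul J (k + 1))
    (hx : M.PhaseTransitionsInteract (M.approx n ul J) t x) : M.time n ul J (k + 1) = t := by
  refine (ht.lt_or_eq.resolve_left fun hlt => ?_).symm
  exact (phaseTransitionsInteract_iff hJ hΩ ha hat ht).1 ⟨x, hx⟩
    ((frontsAt_isResolved hJ hΩ k).nodup_map_position (sub_pos.2 hat) ((lt_time_succ_iff ha).1 hlt))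

/-- The new count is the number of positions hit by an odd number of the old crossings, so the loss
is even and is positive exactly when two crossings share a position. -/
theorem phaseChanges_step {k : ℕ} {t : ℝ} (ht : M.time n ul J (k + 1) = t) :
    (∃ m, M.phaseChanges n ul J k = M.phaseChanges n ul J (k + 1) + 2 * m) ∧
      (M.phaseChanges n ul J (k + 1) < M.phaseChanges n ul J k ↔
        ∃ x, M.PhaseTransitionsInteract (M.approx n ul J) t x) := by
  have hres := frontsAt_isResolved (n := n) hJ hΩ k
  obtain ⟨a, ha, -⟩ := exists_eq_coe_of_le ((monotone_time hJ hΩ (Nat.le_succ k)).trans ht.le)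
  have hat : a < t := by
    have := time_lt_time_succ hJ hΩ ha
    rw [ht, ha] at this
    exact WithTop.coe_lt_coe.1 this
  have hle := (le_time_succ_iff ha).1 ht.ge
  have hnum : M.numPT (profile ul (evolve ul (M.frontsAt n ul J k) (t - a))) =
      M.phaseChanges n ul J (k + 1) := by
    rw [← approx_eq hJ hΩ ha hat ht.ge]
    exact numPT_approx hJ hΩ ht le_rfl (ht ▸ time_lt_time_succ hJ hΩ ht)
  rw [phaseTransitionsInteract_iff hJ hΩ ha hat ht.ge, ← hnum,
    ← hres.numPT_lt_length_iff (sub_pos.2 hat).le hle]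
  exact ⟨hres.exists_length_eq (sub_pos.2 hat).le hle, Iff.rfl⟩

theorem phaseChanges_add (i d : ℕ) {a : ℝ} (ha : M.time n ul J (i + d) = a) :
    (∃ m, M.phaseChanges n ul J i = M.phaseChanges n ul J (i + d) + 2 * m) ∧
      (M.phaseChanges n ul J (i + d) < M.phaseChanges n ul J i ↔
        ∃ e < d, ∃ t : ℝ, M.time n ul J (i + e + 1) = t ∧
          ∃ x, M.PhaseTransitionsInteract (M.approx n ul J) t x) := by
  induction d generalizing a with
  | zero => simp
  | succ d ih =>
    obtain ⟨b, hb, -⟩ := exists_eq_coe_of_le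
      ((monotone_time hJ hΩ (Nat.le_succ (i + d))).trans ha.le)
    obtain ⟨⟨m, hm⟩, hiff⟩ := ih hb
    obtain ⟨⟨m', hm'⟩, hiff'⟩ := phaseChanges_step (k := i + d) hJ hΩ ha
    rw [← Nat.add_assoc]
    refine ⟨⟨m + m', by omega⟩, ?_⟩
    have hor : M.phaseChanges n ul J (i + d + 1) < M.phaseChanges n ul J i ↔
        M.phaseChanges n ul J (i + d) < M.phaseChanges n ul J i ∨
          M.phaseChanges n ul J (i + d + 1) < M.phaseChanges n ul J (i + d) := by omega
    rw [hor, hiff, hiff']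
    constructor
    · rintro (⟨e, he, h⟩ | h)
      · exact ⟨e, by omega, h⟩
      · exact ⟨d, by omega, a, ha, h⟩
    · rintro ⟨e, he, t, ht, h⟩
      rcases Nat.lt_succ_iff_lt_or_eq.1 he with he | rfl
      · exact Or.inl ⟨e, he, t, ht, h⟩
      · have : t = a := WithTop.coe_eq_coe.1 (ht.symm.trans ha)
        exact Or.inr (this ▸ h)

theorem numPT_evolution {s t : ℝ} (hs0 : 0 ≤ s) (hst : s ≤ t) (ht : M.Reached n ul J t) :
    M.numPT (M.approx n ul J t) ≤ M.numPT (M.approx n ul J s) ∧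
      (M.numPT (M.approx n ul J t) < M.numPT (M.approx n ul J s) ↔
        ∃ τ ∈ Ioc s t, ∃ x, M.PhaseTransitionsInteract (M.approx n ul J) τ x) ∧
      Even (M.numPT (M.approx n ul J s) - M.numPT (M.approx n ul J t)) := by
  have hmono := monotone_time (n := n) hJ hΩ
  have hreach : ∀ r ≤ t, M.Reached n ul J r := fun r hr =>
    ht.imp fun k hk => (WithTop.coe_le_coe.2 hr).trans hk
  obtain ⟨i, a, ha, has, hs⟩ := exists_index hJ hΩ hs0 (hreach s hst)
  obtain ⟨j, b, hb, hbt, htj⟩ := exists_index hJ hΩ (hs0.trans hst) ht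
  have hij : i ≤ j := by
    by_contra h
    have h1 := hmono (show j + 1 ≤ i by omega)
    rw [ha] at h1
    exact absurd (WithTop.coe_lt_coe.1 (htj.trans_le h1)) (not_lt.2 (has.trans hst))
  obtain ⟨d, rfl⟩ := Nat.exists_eq_add_of_le hij
  obtain ⟨⟨m, hm⟩, hiff⟩ := phaseChanges_add hJ hΩ i d hb
  rw [numPT_approx hJ hΩ ha has hs, numPT_approx hJ hΩ hb hbt htj]
  refine ⟨by omega, ?_, ⟨m, by omega⟩⟩
  rw [hiff]
  constructor
  · rintro ⟨e, he, τ, hτ, hx⟩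
    refine ⟨τ, ⟨?_, ?_⟩, hx⟩
    · have := hs.trans_le (hmono (show i + 1 ≤ i + e + 1 by omega))
      rw [hτ] at this
      exact WithTop.coe_lt_coe.1 this
    · have := hmono (show i + e + 1 ≤ i + d by omega)
      rw [hτ, hb] at this
      exact (WithTop.coe_le_coe.1 this).trans hbt
  · rintro ⟨τ, ⟨hsτ, hτt⟩, x, hx⟩
    obtain ⟨k, c, hc, hcτ, hle⟩ := exists_window (hs0.trans_lt hsτ) (hreach τ hτt)
    -- An interaction of phase transitions cannot lie strictly between two interaction times, so `τ`
    -- is one of the times already accounted for by `phaseChanges_add`.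
    have heq := eq_time_succ_of_interact hJ hΩ hc hcτ hle hx
    have hik : i ≤ k := by
      by_contra h
      have h1 := hmono (show k + 1 ≤ i by omega)
      rw [heq, ha] at h1
      linarith [WithTop.coe_le_coe.1 h1]
    have hkd : k < i + d := by
      by_contra h
      have h1 := htj.trans_le (hmono (show i + d + 1 ≤ k + 1 by omega))
      rw [heq] at h1
      exact absurd (WithTop.coe_lt_coe.1 h1) (not_lt.2 hτt)
    refine ⟨k - i, by omega, τ, ?_, x, hx⟩
    rwa [show i + (k - i) + 1 = k + 1 by omega]

theorem finite_phaseTransitions_approx {t : ℝ} (ht0 : 0 ≤ t) (ht : M.Reached n ul J t) :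
    (M.phaseTransitions (M.approx n ul J t)).Finite := by
  rcases ht0.lt_or_eq with ht0 | rfl
  · obtain ⟨k, a, ha, hat, hle⟩ := exists_window ht0 ht
    rw [approx_eq hJ hΩ ha hat hle]
    exact (frontsAt_isResolved hJ hΩ k).finite_phaseTransitions (sub_pos.2 hat).le
      ((le_time_succ_iff ha).1 hle)
  · rw [approx_of_nonpos hJ hΩ le_rfl, phaseTransitions_profile hΩ (hJ.imp fun h => h.le)]
    exact setOf_odd_count_finite _

theorem mem_Ge_of_isPhaseTransition {t : ℝ} (ht0 : 0 < t) (ht : M.Reached n ul J t) {x : ℝ}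
    {um up : State} (hx : ¬ FrontsInteract (M.approx n ul J) t x)
    (h : M.IsPhaseTransition (M.approx n ul J t) x um up) : (um, up) ∈ M.Ge := by
  obtain ⟨k, a, ha, hat, hle⟩ := exists_window ht0 ht
  rw [approx_eq hJ hΩ ha hat hle] at h
  rcases (frontsAt_isResolved hJ hΩ k).mem_Ge_or_exists_lt (sub_pos.2 hat).le
    ((le_time_succ_iff ha).1 hle) h with h | ⟨b, hb, c, hc, hbc, h1, h2⟩
  · exact h
  · exact absurd (frontsInteract_of_position_eq hJ hΩ ha hat hle hb hc hbc h1 h2) hx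

end Interactions

end Model

end TwoPhase

theorem lemma2p5 (M : TwoPhase.Model) (n : ℕ)
    -- the initial datum: leftmost state and jumps, with values in the grid
    (ul : TwoPhase.State) (J : List (ℝ × TwoPhase.State))
    (hJ : (J.map Prod.fst).Pairwise (· < ·))
    (hul : ul ∈ M.grid n) (hJn : ∀ a ∈ J, a.2 ∈ M.grid n) :
    -- condition (E.3), away from the interaction points
    (∀ t, 0 < t → M.Reached n ul J t → ∀ x um up,
      ¬ TwoPhase.FrontsInteract (M.approx n ul J) t x →
      M.IsPhaseTransition (M.approx n ul J t) x um up → (um, up) ∈ M.Ge) ∧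
    -- the number of phase transitions is finite
    (∀ t, 0 ≤ t → M.Reached n ul J t → (M.phaseTransitions (M.approx n ul J t)).Finite) ∧
    -- its evolution between two times
    ∀ s t, 0 ≤ s → s ≤ t → M.Reached n ul J t →
      M.numPT (M.approx n ul J t) ≤ M.numPT (M.approx n ul J s) ∧
      (M.numPT (M.approx n ul J t) < M.numPT (M.approx n ul J s) ↔
        ∃ τ ∈ Set.Ioc s t, ∃ x, M.PhaseTransitionsInteract (M.approx n ul J) τ x) ∧
      Even (M.numPT (M.approx n ul J s) - M.numPT (M.approx n ul J t)) := by
  have hJ' : J.Pairwise fun a b => a.1 < b.1 := List.pairwise_map.1 hJ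
  have hΩ : ∀ u ∈ ul :: J.map Prod.snd, u ∈ M.Omega := by
    refine List.forall_mem_cons.2 ⟨hul.1, fun u hu => ?_⟩
    obtain ⟨a, ha, rfl⟩ := List.mem_map.1 hu
    exact (hJn a ha).1
  exact ⟨fun t ht0 ht x um up hx h =>
      TwoPhase.Model.mem_Ge_of_isPhaseTransition hJ' hΩ ht0 ht hx h,
    fun t ht0 ht => TwoPhase.Model.finite_phaseTransitions_approx hJ' hΩ ht0 ht,
    fun s t hs0 hst ht => TwoPhase.Model.numPT_evolution hJ' hΩ hs0 hst ht⟩
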